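/- Let $(\Omega,\mathcal A,P)$ be a probability space, $(\mathcal U_n)_{n\ge 0}$ a filtration, and $(X_n)_{n\ge 1}$ a sequence of real integrable random variables adapted to $(\mathcal U_n)$. Put $$\overline X_n=\frac1n\sum_{i=1}^n X_i,\qquad Z_n=E(X_{n+1}\mid\mathcal U_n)\quad(n\ge 0).$$ Suppose that $(X_n^2)$ is uniformly integrable and that (j) $n^3\,E\bigl\{\bigl(E(Z_{n+1}\mid\mathcal U_n)-Z_n\bigr)^2\bigr\}\longrightarrow 0$. Then there is a real random variable $Z$ such that $Z_n\to Z$ a.s. and $\overline X_n\to Z$ a.s. Moreover, if $U$ and $V$ are real random variables such that (jj) $E\bigl\{\sup_{k\ge 1}\sqrt k\,|Z_{k-1}-Z_k|\bigr\}<\infty$, (jjj) $\frac1n\sum_{k=1}^n\bigl\{X_k-Z_{k-1}+k(Z_{k-1}-Z_k)\bigr\}^2\longrightarrow U$ in probability, (jv) $n\sum_{k\ge n}(Z_{k-1}-Z_k)^2\longrightarrow V$ a.s., then $$\sqrt n\,\{\overline X_n-Z_n\}\longrightarrow\mathcal N(0,U)\ \text{ stably}\qquad\text{and}\qquad \sqrt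 n\,\{\overline X_n-Z\}\longrightarrow\mathcal N(0,U+V)\ \text{ stably}.$$ Here $\mathcal N(0,a)$ is the Gaussian law with mean $0$ and variance $a\ge 0$, with $\mathcal N(0,0)=\delta_0$ (note that $U,V\ge 0$ a.s.), and random variables $Y_n$ converge stably to a random probability measure $K$ on $\mathbb R$ if $E\{f(Y_n)\mid H\}\to E\{K(f)\mid H\}$ for every $H\in\mathcal A$ with $P(H)>0$ and every bounded continuous $f:\mathbb R\to\mathbb R$, where $K(f)(\omega)=\int f\,dK(\omega)$. -/

import Mathlib

open MeasureTheory ProbabilityTheory Filter Topology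
open scoped BoundedContinuousFunction

noncomputable section

/-- The random probability measure `ω ↦ N(0, V ω)`, for a real random variable `V`. It is meant
for `V ≥ 0` almost surely; on the null set where `V < 0` its value is `N(0, 0) = δ₀`. -/
def centeredGaussianKernel {Ω : Type*} [MeasurableSpace Ω] (V : Ω → ℝ) (hV : Measurable V) :
    Kernel Ω ℝ where
  toFun ω := gaussianReal 0 (V ω).toNNReal
  measurable' :=
    measurable_gaussianReal.comp (measurable_const.prodMk hV.real_toNNReal)

instance instIsMarkovKernelCenteredGaussianKernel {Ω : Type*} [MeasurableSpace Ω] (V : Ω → ℝ)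
    (hV : Measurable V) : IsMarkovKernel (centeredGaussianKernel V hV) :=
  ⟨fun ω => inferInstanceAs (IsProbabilityMeasure (gaussianReal 0 (V ω).toNNReal))⟩

/-- Stable convergence of a sequence of `S`-valued random variables `Y n` to a random
probability measure `K`:
`E(f(Y n) ∣ H) → E(K(f) ∣ H)` for every event `H` of positive probability and every bounded
continuous real function `f` on `S`. -/
def StablyConverges {Ω S : Type*} [MeasurableSpace Ω] [TopologicalSpace S] [MeasurableSpace S]
    [BorelSpace S] (P : Measure Ω) (Y : ℕ → Ω → S) (K : Kernel Ω S) [IsMarkovKernel K] : Prop :=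
  ∀ H : Set Ω, MeasurableSet H → 0 < P H → ∀ f : S →ᵇ ℝ,
    Tendsto (fun n => ∫ ω, f (Y n ω) ∂(P[|H])) atTop
      (𝓝 (∫ ω, (∫ x, f x ∂(K ω)) ∂(P[|H])))

/-- The sample mean `(X₁ + ⋯ + Xₙ) / n`. -/
def sampleMean {Ω : Type*} (X : ℕ → Ω → ℝ) (n : ℕ) (ω : Ω) : ℝ :=
  (∑ i ∈ Finset.Icc 1 n, X i ω) / n

/-- The one-step predictor `Zₙ = E(Xₙ₊₁ ∣ 𝒰ₙ)`. -/
def predictor {Ω : Type*} {mΩ : MeasurableSpace Ω} (P : Measure Ω) (𝒰 : Filtration ℕ mΩ)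
    (X : ℕ → Ω → ℝ) (n : ℕ) : Ω → ℝ :=
  P[X (n + 1) | 𝒰 n]

/-- `E {sup_{k ≥ 1} √k |Z_{k-1} - Z_k|} < ∞`, the supremum and the expectation being taken
in `[0, ∞]`; the index is `k = i + 1`. -/
def IncrementSupIntegrable {Ω : Type*} [MeasurableSpace Ω] (P : Measure Ω)
    (Z : ℕ → Ω → ℝ) : Prop :=
  ∫⁻ ω, (⨆ i : ℕ, ENNReal.ofReal (Real.sqrt ((i : ℝ) + 1) * |Z i ω - Z (i + 1) ω|)) ∂P < ⊤

/-- `(1/n) ∑_{k=1}^n {X_k - Z_{k-1} + k (Z_{k-1} - Z_k)}² → U` in probability. -/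
def NormalizedSquaresTendsto {Ω : Type*} [MeasurableSpace Ω] (P : Measure Ω)
    (X Z : ℕ → Ω → ℝ) (U : Ω → ℝ) : Prop :=
  TendstoInMeasure P
    (fun (n : ℕ) ω => (1 / (n : ℝ)) *
      ∑ k ∈ Finset.Icc 1 n, (X k ω - Z (k - 1) ω + (k : ℝ) * (Z (k - 1) ω - Z k ω)) ^ 2)
    atTop U

/-- `n ∑_{k ≥ n} (Z_{k-1} - Z_k)² → V` almost surely. The limit being finite, the series
converges almost surely. The sequence is written from `n = 1` on, with `n + 1` for `n` and
`k = n + 1 + i`. -/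
def TailSquaresTendsto {Ω : Type*} [MeasurableSpace Ω] (P : Measure Ω)
    (Z : ℕ → Ω → ℝ) (V : Ω → ℝ) : Prop :=
  ∀ᵐ ω ∂P, Summable (fun i : ℕ => (Z i ω - Z (i + 1) ω) ^ 2) ∧
    Tendsto (fun n : ℕ => ((n : ℝ) + 1) * ∑' i : ℕ, (Z (n + i) ω - Z (n + i + 1) ω) ^ 2)
      atTop (𝓝 (V ω))

end

/-! ### Deterministic estimates -/

/-! Telescoping gives √n (X̄ₙ - Zₙ) = n^{-1/2} ∑_{k<n} {X_{k+1} - Z_k + (k+1)(Z_k - Z_{k+1})} and √n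
(Zₙ - Z_m) = √n ∑_{n≤k<m} (Z_k - Z_{k+1}). Both normalized errors are therefore row sums of one
array, up to a small error: the row stops at n for the first limit, and for the second at an r n so
large that √n (Z_{r n} - Z) is negligible (`exists_seq_tendstoInMeasure_smul`). The squares of a row
add up to the expressions in (jjj) and (jv), whence the variances U and U + V
(`sum_sq_uncenteredArray`).

These terms are not martingale differences, because Z_{k+1} - Z_k has the drift E(Z_{k+1} | 𝒰_k) -
Z_k. By (j) the drift is o(k^{-3/2}) in L², which is enough for the weighted sums of the drifts and
of their squares to vanish (`IsNearMartingale.tendsto_sum_rowWeight`,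
`IsNearMartingale.tendsto_sum_rowWeight_sq`). Replacing increments by innovations yields the
martingale difference array `diffArray`. Its largest increment tends to 0 in mean: uniform
integrability handles the X part, while (jj), (jv) and (j) handle the Z part
(`IsPredictableSequence.tendsto_lintegral_iSup_diffArray`).

The stable limit theorem for such arrays is proved by McLeish's product method. Since e^{iu} = (1 +
iu) e^{-u²/2} + O(|u|³), exp(it ∑ x_k) is close to ∏ (1 + it x_k) times exp(-t² ∑ x_k² / 2). The
product, stopped when ∑ x_k² passes a level, is a complex martingale whose first factors tend to 1,
so in the limit it integrates like 1 against every bounded random variable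
(`IsDominatedDiffArray.tendsto_integral_mul_expProduct`). What is left is E(ξ exp(-t² W / 2)), the
transform of a Gaussian mixture; taking for ξ the indicator of H gives stable convergence.

For the almost sure statements, Zₙ - Z₀ is an L¹-bounded martingale plus an absolutely convergent
sum of drifts, and ∑ (X_{k+1} - Z_k)/(k+1) is an L²-bounded martingale, to which Kronecker's lemma
applies. -/

/-- Both expressions expand as 1 + iu - u²/2 up to third order. The three remainders cost 2/9, 1/4
and 1/2 times |u|³, and these constants add up to less than 1. -/
theorem norm_cexp_sub_le_abs_pow_three {u : ℝ} (hu : |u| ≤ 1) :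
    ‖Complex.exp (u * Complex.I) - (1 + u * Complex.I) * (Real.exp (-(u ^ 2 / 2)) : ℝ)‖
      ≤ |u| ^ 3 := by
  have hn : ‖(u * Complex.I : ℂ)‖ = |u| := by simp
  have h1 : ‖Complex.exp (u * Complex.I) - (1 + u * Complex.I - (u ^ 2 / 2 : ℝ))‖
      ≤ 2 / 9 * |u| ^ 3 := by
    have h := Complex.exp_bound (x := u * Complex.I) (by rw [hn]; exact hu) (n := 3) (by norm_num)
    rw [hn] at h
    have e : ∑ m ∈ Finset.range 3, (u * Complex.I) ^ m / (m.factorial : ℂ)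
        = 1 + u * Complex.I - (u ^ 2 / 2 : ℝ) := by
      simp [Finset.sum_range_succ, mul_pow]
      ring
    rw [e] at h
    refine h.trans (le_of_eq ?_)
    norm_num [Nat.factorial]
    ring
  set v : ℝ := u ^ 2 / 2 with hv
  have hu2 : u ^ 2 ≤ 1 := by rw [← sq_abs]; exact pow_le_one₀ (abs_nonneg _) hu
  have hv0 : 0 ≤ v := by positivity
  have h2 : |Real.exp (-v) - 1 + v| ≤ v ^ 2 := by
    have h := Real.abs_exp_sub_one_sub_id_le (x := -v) (by rw [abs_neg, abs_of_nonneg hv0]; linarith)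
    simpa using h
  have h3 : |Real.exp (-v) - 1| ≤ v := by
    have := Real.add_one_le_exp (-v)
    have := Real.exp_le_one_iff.2 (neg_nonpos.2 hv0)
    rw [abs_le]; constructor <;> linarith
  have e : Complex.exp (u * Complex.I) - (1 + u * Complex.I) * (Real.exp (-v) : ℝ)
      = (Complex.exp (u * Complex.I) - (1 + u * Complex.I - (v : ℝ)))
        - ((Real.exp (-v) - 1 + v : ℝ) : ℂ)
        - (u * Complex.I) * ((Real.exp (-v) - 1 : ℝ) : ℂ) := by
    push_cast; ring
  rw [e]
  have h4 : ‖((Real.exp (-v) - 1 + v : ℝ) : ℂ)‖ ≤ 1 / 4 * |u| ^ 3 := by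
    rw [Complex.norm_real, Real.norm_eq_abs]
    refine h2.trans ?_
    have : v ^ 2 = 1 / 4 * (|u| ^ 3 * |u|) := by rw [hv, ← sq_abs u]; ring
    rw [this]
    have : |u| ^ 3 * |u| ≤ |u| ^ 3 := mul_le_of_le_one_right (by positivity) hu
    linarith
  have h5 : ‖(u * Complex.I) * ((Real.exp (-v) - 1 : ℝ) : ℂ)‖ ≤ 1 / 2 * |u| ^ 3 := by
    rw [norm_mul, hn, Complex.norm_real, Real.norm_eq_abs]
    refine (mul_le_mul_of_nonneg_left h3 (abs_nonneg _)).trans (le_of_eq ?_)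
    rw [hv, ← sq_abs]; ring
  have h6 := norm_sub_le ((Complex.exp (u * Complex.I) - (1 + u * Complex.I - (v : ℝ)))
        - ((Real.exp (-v) - 1 + v : ℝ) : ℂ)) ((u * Complex.I) * ((Real.exp (-v) - 1 : ℝ) : ℂ))
  have h7 := norm_sub_le (Complex.exp (u * Complex.I) - (1 + u * Complex.I - (v : ℝ)))
        ((Real.exp (-v) - 1 + v : ℝ) : ℂ)
  have : 0 ≤ |u| ^ 3 := by positivity
  linarith

theorem norm_one_add_mul_I_sq (u : ℝ) : ‖(1 + u * Complex.I : ℂ)‖ ^ 2 = 1 + u ^ 2 := by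
  rw [← Complex.normSq_eq_norm_sq, Complex.normSq_apply]
  simp
  ring

theorem norm_one_add_mul_I_mul_exp_le_one (u : ℝ) :
    ‖(1 + u * Complex.I : ℂ) * (Real.exp (-(u ^ 2 / 2)) : ℝ)‖ ≤ 1 := by
  rw [← pow_le_one_iff_of_nonneg (norm_nonneg _) two_ne_zero, norm_mul, mul_pow,
    norm_one_add_mul_I_sq, Complex.norm_real, Real.norm_eq_abs, abs_of_pos (Real.exp_pos _),
    ← Real.exp_nat_mul]
  have h : ((2 : ℕ) : ℝ) * -(u ^ 2 / 2) = -(u ^ 2) := by push_cast; ring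
  rw [h, Real.exp_neg, ← div_eq_mul_inv, div_le_one (Real.exp_pos _), add_comm]
  exact Real.add_one_le_exp _

/-- Exchange the factors one at a time; the others have modulus at most 1 and do not amplify the
error. -/
theorem norm_prod_sub_prod_le_sum (a b : ℕ → ℂ) (ha : ∀ k, ‖a k‖ ≤ 1) (hb : ∀ k, ‖b k‖ ≤ 1)
    (m : ℕ) :
    ‖∏ k ∈ Finset.range m, a k - ∏ k ∈ Finset.range m, b k‖
      ≤ ∑ k ∈ Finset.range m, ‖a k - b k‖ := by
  induction m with
  | zero => simp
  | succ m ih =>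
    rw [Finset.prod_range_succ, Finset.prod_range_succ, Finset.sum_range_succ]
    have hA : ‖∏ k ∈ Finset.range m, a k‖ ≤ 1 := by
      rw [norm_prod]; exact Finset.prod_le_one (fun _ _ => norm_nonneg _) fun k _ => ha k
    have e : (∏ k ∈ Finset.range m, a k) * a m - (∏ k ∈ Finset.range m, b k) * b m
        = (∏ k ∈ Finset.range m, a k) * (a m - b m)
          + (∏ k ∈ Finset.range m, a k - ∏ k ∈ Finset.range m, b k) * b m := by ring
    rw [e]
    refine (norm_add_le _ _).trans ?_
    rw [norm_mul, norm_mul, add_comm]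
    refine add_le_add ?_ ?_
    · exact (mul_le_of_le_one_right (norm_nonneg _) (hb m)).trans ih
    · exact mul_le_of_le_one_left (norm_nonneg _) hA

/-- The product `∏_{k < m} (1 + i t xₖ)`. -/
noncomputable def expProduct (t : ℝ) (x : ℕ → ℝ) (m : ℕ) : ℂ :=
  ∏ k ∈ Finset.range m, (1 + ((t * x k : ℝ) : ℂ) * Complex.I)

/-- The sequence `x`, set to zero as soon as the sum of the squares of its preceding terms
exceeds `C`. -/
noncomputable def squareTruncation (C : ℝ) (x : ℕ → ℝ) (k : ℕ) : ℝ :=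
  if ∑ j ∈ Finset.range k, x j ^ 2 ≤ C then x k else 0

theorem expProduct_succ (t : ℝ) (x : ℕ → ℝ) (m : ℕ) :
    expProduct t x (m + 1) = expProduct t x m * (1 + ((t * x m : ℝ) : ℂ) * Complex.I) :=
  Finset.prod_range_succ _ _

theorem norm_exp_sum_sub_expProduct_le (t : ℝ) (x : ℕ → ℝ) (g : ℝ) (m : ℕ)
    (hx : ∀ k, |x k| ≤ g) (hg : |t| * g ≤ 1) :
    ‖Complex.exp ((t * ∑ k ∈ Finset.range m, x k : ℝ) * Complex.I)
        - expProduct t x m * (Real.exp (-(t ^ 2 * ∑ k ∈ Finset.range m, x k ^ 2) / 2) : ℝ)‖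
      ≤ |t| ^ 3 * g * ∑ k ∈ Finset.range m, x k ^ 2 := by
  have e1 : Complex.exp ((t * ∑ k ∈ Finset.range m, x k : ℝ) * Complex.I)
      = ∏ k ∈ Finset.range m, Complex.exp (((t * x k : ℝ) : ℂ) * Complex.I) := by
    rw [← Complex.exp_sum, ← Finset.sum_mul, ← Complex.ofReal_sum, Finset.mul_sum]
  have e2 : expProduct t x m * (Real.exp (-(t ^ 2 * ∑ k ∈ Finset.range m, x k ^ 2) / 2) : ℝ)
      = ∏ k ∈ Finset.range m, ((1 + ((t * x k : ℝ) : ℂ) * Complex.I)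
          * (Real.exp (-((t * x k) ^ 2 / 2)) : ℝ)) := by
    rw [Finset.prod_mul_distrib, expProduct, ← Complex.ofReal_prod, ← Real.exp_sum,
      Finset.mul_sum, ← Finset.sum_neg_distrib, Finset.sum_div]
    congr 4
    ext k; ring
  rw [e1, e2]
  refine (norm_prod_sub_prod_le_sum _ _ (fun k => ?_)
    (fun k => norm_one_add_mul_I_mul_exp_le_one _) m).trans ?_
  · rw [Complex.norm_exp_ofReal_mul_I]
  · rw [Finset.mul_sum]
    refine Finset.sum_le_sum fun k _ => ?_
    have hk : |t * x k| ≤ |t| * g := by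
      rw [abs_mul]; exact mul_le_mul_of_nonneg_left (hx k) (abs_nonneg _)
    refine (norm_cexp_sub_le_abs_pow_three (hk.trans hg)).trans ?_
    rw [abs_mul, mul_pow, ← sq_abs (x k), mul_assoc]
    refine mul_le_mul_of_nonneg_left ?_ (by positivity)
    rw [pow_succ, mul_comm]
    exact mul_le_mul_of_nonneg_right (hx k) (by positivity)

theorem sum_sq_range_mono (x : ℕ → ℝ) : Monotone fun m => ∑ k ∈ Finset.range m, x k ^ 2 :=
  monotone_nat_of_le_succ fun m => by
    rw [Finset.sum_range_succ]; linarith [sq_nonneg (x m)]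

theorem norm_expProduct_squareTruncation_sq_le_exp {t C : ℝ} {x : ℕ → ℝ} (m : ℕ)
    (hm : ∑ k ∈ Finset.range m, x k ^ 2 ≤ C) :
    ‖expProduct t (squareTruncation C x) m‖ ^ 2
      ≤ Real.exp (t ^ 2 * ∑ k ∈ Finset.range m, x k ^ 2) := by
  induction m with
  | zero => simp [expProduct]
  | succ m ih =>
    have hm' : ∑ k ∈ Finset.range m, x k ^ 2 ≤ C :=
      (sum_sq_range_mono x (Nat.le_succ m)).trans hm
    rw [expProduct_succ, norm_mul, mul_pow, norm_one_add_mul_I_sq, squareTruncation, if_pos hm',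
      Finset.sum_range_succ, mul_add (t ^ 2), Real.exp_add]
    refine mul_le_mul (ih hm') ?_ (by positivity) (by positivity)
    rw [mul_pow, add_comm]
    exact Real.add_one_le_exp _

theorem norm_expProduct_squareTruncation_le_of_le {t C : ℝ} {x : ℕ → ℝ} (m : ℕ)
    (hm : ∑ k ∈ Finset.range m, x k ^ 2 ≤ C) :
    ‖expProduct t (squareTruncation C x) m‖ ≤ Real.exp (t ^ 2 * C / 2) := by
  rw [← pow_le_pow_iff_left₀ (norm_nonneg _) (Real.exp_nonneg _) two_ne_zero, ← Real.exp_nat_mul]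
  refine (norm_expProduct_squareTruncation_sq_le_exp m hm).trans (Real.exp_le_exp.2 ?_)
  push_cast
  nlinarith [sq_nonneg t]

theorem norm_one_add_mul_I_le (u : ℝ) : ‖(1 + u * Complex.I : ℂ)‖ ≤ 1 + |u| := by
  refine (norm_add_le _ _).trans ?_
  simp

/-- The truncation keeps the term that carries the sum of squares across `C`. Up to that term the
product is at most exp(t²C/2), the crossing factor contributes at most 1 + |t|g, and all later
factors equal 1. -/
theorem norm_expProduct_squareTruncation_le {t C g : ℝ} (hC : 0 ≤ C) {x : ℕ → ℝ}
    (hx : ∀ k, |x k| ≤ g) (m : ℕ) :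
    ‖expProduct t (squareTruncation C x) m‖ ≤ Real.exp (t ^ 2 * C / 2) * (1 + |t| * g) := by
  have hg : 0 ≤ g := (abs_nonneg _).trans (hx 0)
  induction m with
  | zero =>
    simp only [expProduct, Finset.range_zero, Finset.prod_empty, norm_one]
    exact one_le_mul_of_one_le_of_one_le (Real.one_le_exp (by positivity))
      (le_add_of_nonneg_right (by positivity))
  | succ m ih =>
    rw [expProduct_succ, norm_mul]
    by_cases hm : ∑ k ∈ Finset.range m, x k ^ 2 ≤ C
    · rw [squareTruncation, if_pos hm]
      refine mul_le_mul (norm_expProduct_squareTruncation_le_of_le m hm) ?_ (by positivity)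
        (by positivity)
      refine (norm_one_add_mul_I_le _).trans ?_
      rw [abs_mul]
      gcongr
      exact hx m
    · rw [squareTruncation, if_neg hm]
      simpa using ih

theorem norm_expProduct_mul_squareTruncation_le {t C g : ℝ} {x : ℕ → ℝ}
    (hx : ∀ k, |x k| ≤ g) (m : ℕ) :
    ‖expProduct t (squareTruncation C x) m * ((squareTruncation C x m : ℝ) : ℂ)‖
      ≤ Real.exp (t ^ 2 * C / 2) * g := by
  have hg : 0 ≤ g := (abs_nonneg _).trans (hx 0)
  by_cases hm : ∑ k ∈ Finset.range m, x k ^ 2 ≤ C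
  · rw [norm_mul, Complex.norm_real, Real.norm_eq_abs]
    refine mul_le_mul (norm_expProduct_squareTruncation_le_of_le m hm) ?_ (by positivity)
      (by positivity)
    rw [squareTruncation, if_pos hm]
    exact hx m
  · rw [squareTruncation, if_neg hm]
    simp only [Complex.ofReal_zero, mul_zero, norm_zero]
    positivity

/-- Used with `m` fixed and `g` small: the beginning of a row has asymptotically no influence on the
product. -/
theorem norm_expProduct_squareTruncation_sub_one_le {t C g : ℝ} {x : ℕ → ℝ}
    (hx : ∀ k, |x k| ≤ g) (m : ℕ) :
    ‖expProduct t (squareTruncation C x) m - 1‖ ≤ m * (|t| * (Real.exp (t ^ 2 * C / 2) * g)) := by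
  induction m with
  | zero => simp [expProduct]
  | succ m ih =>
    have e : expProduct t (squareTruncation C x) (m + 1) - 1
        = (expProduct t (squareTruncation C x) m - 1)
          + (t : ℂ) * Complex.I *
            (expProduct t (squareTruncation C x) m * ((squareTruncation C x m : ℝ) : ℂ)) := by
      rw [expProduct_succ]; push_cast; ring
    rw [e]
    refine (norm_add_le _ _).trans ?_
    rw [norm_mul]
    have h1 : ‖(t : ℂ) * Complex.I‖ = |t| := by simp
    have h2 := mul_le_mul_of_nonneg_left
      (norm_expProduct_mul_squareTruncation_le (t := t) (C := C) hx m) (abs_nonneg t)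
    rw [h1]
    push_cast
    linarith

theorem expProduct_squareTruncation_of_le {t C : ℝ} {x : ℕ → ℝ} {m : ℕ}
    (hm : ∑ k ∈ Finset.range m, x k ^ 2 ≤ C) :
    expProduct t (squareTruncation C x) m = expProduct t x m := by
  refine Finset.prod_congr rfl fun k hk => ?_
  rw [squareTruncation, if_pos]
  exact (sum_sq_range_mono x (Finset.mem_range.1 hk).le).trans hm

/-! ### The central limit theorem for martingale arrays -/

theorem integral_smul_eq_zero_of_condExp_eq_zero {Ω E : Type*} [NormedAddCommGroup E]
    [NormedSpace ℝ E] [CompleteSpace E] {m mΩ : MeasurableSpace Ω} {P : Measure Ω}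
    [IsFiniteMeasure P] (hm : m ≤ mΩ) {y : Ω → ℝ} {φ : Ω → E}
    (hφ : StronglyMeasurable[m] φ) (hy : Integrable y P) (hyφ : Integrable (y • φ) P)
    (h0 : P[y | m] =ᵐ[P] 0) : ∫ ω, y ω • φ ω ∂P = 0 := by
  have h1 : P[y • φ | m] =ᵐ[P] 0 := by
    refine (condExp_smul_of_aestronglyMeasurable_right hy hyφ hφ.aestronglyMeasurable).trans ?_
    filter_upwards [h0] with ω hω
    simp [hω]
  have h2 : ∫ ω, (y • φ) ω ∂P = ∫ ω, (P[y • φ | m]) ω ∂P := (integral_condExp hm).symm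
  rw [integral_congr_ae h1] at h2
  simpa using h2

theorem integral_eq_zero_of_condExp_eq_zero {Ω : Type*} {m mΩ : MeasurableSpace Ω}
    {P : Measure Ω} [IsFiniteMeasure P] (hm : m ≤ mΩ) {φ y : Ω → ℝ}
    (hφ : StronglyMeasurable[m] φ) (hy : Integrable y P)
    (hyφ : Integrable (fun ω => φ ω * y ω) P)
    (h0 : P[y | m] =ᵐ[P] 0) : ∫ ω, φ ω * y ω ∂P = 0 := by
  have := integral_smul_eq_zero_of_condExp_eq_zero hm hφ hy
    (by refine hyφ.congr (ae_of_all _ fun ω => ?_); simp [mul_comm]) h0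
  rw [← this]
  exact integral_congr_ae (ae_of_all _ fun ω => by simp [mul_comm])

section Row

variable {Ω : Type*} {mΩ : MeasurableSpace Ω} {P : Measure Ω}
  {𝒰 : Filtration ℕ mΩ}

theorem measurable_squareTruncation {x : ℕ → Ω → ℝ} (hx : ∀ k, Measurable[𝒰 (k + 1)] (x k))
    (C : ℝ) (k : ℕ) : Measurable[𝒰 (k + 1)] fun ω => squareTruncation C (fun k => x k ω) k := by
  refine Measurable.ite (measurableSet_le ?_ measurable_const) (hx k) measurable_const
  refine Finset.measurable_sum _ fun j hj => Measurable.pow_const ?_ 2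
  exact (hx j).mono (𝒰.mono (by have := Finset.mem_range.1 hj; omega)) le_rfl

theorem measurable_expProduct_squareTruncation {x : ℕ → Ω → ℝ}
    (hx : ∀ k, Measurable[𝒰 (k + 1)] (x k)) (t C : ℝ) (m : ℕ) :
    Measurable[𝒰 m] fun ω => expProduct t (squareTruncation C fun k => x k ω) m := by
  refine Finset.measurable_prod _ fun k hk => ?_
  refine measurable_const.add (Measurable.mul_const ?_ _)
  refine Complex.measurable_ofReal.comp (measurable_const.mul ?_)
  exact (measurable_squareTruncation hx C k).mono
    (𝒰.mono (by have := Finset.mem_range.1 hk; omega)) le_rfl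

/-- The decision to keep the k-th term depends only on earlier terms, so truncation multiplies it by
the indicator of an event in `𝒰 k` and preserves the martingale difference property. -/
theorem condExp_squareTruncation {x : ℕ → Ω → ℝ} (hx : ∀ k, Measurable[𝒰 (k + 1)] (x k))
    (hint : ∀ k, Integrable (x k) P) (h0 : ∀ k, P[x k | 𝒰 k] =ᵐ[P] 0) (C : ℝ) (k : ℕ) :
    Integrable (fun ω => squareTruncation C (fun k => x k ω) k) P ∧
      P[fun ω => squareTruncation C (fun k => x k ω) k | 𝒰 k] =ᵐ[P] 0 := by
  set s : Set Ω := {ω | ∑ j ∈ Finset.range k, x j ω ^ 2 ≤ C} with hs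
  have hsm : MeasurableSet[𝒰 k] s := by
    refine measurableSet_le ?_ measurable_const
    refine Finset.measurable_sum _ fun j hj => Measurable.pow_const ?_ 2
    exact (hx j).mono (𝒰.mono (by have := Finset.mem_range.1 hj; omega)) le_rfl
  have e : (fun ω => squareTruncation C (fun k => x k ω) k) = s.indicator (x k) := by
    ext ω
    simp only [squareTruncation, Set.indicator, hs, Set.mem_ofPred_eq]
  rw [e]
  refine ⟨(hint k).indicator (𝒰.le k _ hsm), ?_⟩
  refine (condExp_indicator (hint k) hsm).trans ?_
  filter_upwards [h0 k] with ω hω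
  simp [Set.indicator, hω]

theorem integrable_expProduct_squareTruncation [IsProbabilityMeasure P] {x : ℕ → Ω → ℝ}
    (hx : ∀ k, Measurable[𝒰 (k + 1)] (x k)) {g : Ω → ℝ} (hg : Integrable g P)
    (hxg : ∀ᵐ ω ∂P, ∀ k, |x k ω| ≤ g ω) (t : ℝ) {C : ℝ} (hC : 0 ≤ C) (m : ℕ) :
    Integrable (fun ω => expProduct t (squareTruncation C fun k => x k ω) m) P := by
  refine Integrable.mono' (((integrable_const (1 : ℝ)).add (hg.const_mul |t|)).const_mul
    (Real.exp (t ^ 2 * C / 2)))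
    (((measurable_expProduct_squareTruncation hx t C m).mono (𝒰.le m) le_rfl).aestronglyMeasurable)
    ?_
  filter_upwards [hxg] with ω hω
  exact norm_expProduct_squareTruncation_le hC hω m

theorem integral_mul_expProduct_succ [IsProbabilityMeasure P] {x : ℕ → Ω → ℝ}
    (hx : ∀ k, Measurable[𝒰 (k + 1)] (x k))
    (hint : ∀ k, Integrable (x k) P) (h0 : ∀ k, P[x k | 𝒰 k] =ᵐ[P] 0)
    {g : Ω → ℝ} (hg : Integrable g P)
    (hxg : ∀ᵐ ω ∂P, ∀ k, |x k ω| ≤ g ω) (t : ℝ) {C : ℝ} (hC : 0 ≤ C) {m : ℕ}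
    {η : Ω → ℝ} (hη : StronglyMeasurable[𝒰 m] η) {B : ℝ} (hB : ∀ᵐ ω ∂P, |η ω| ≤ B) :
    ∫ ω, (η ω : ℂ) * expProduct t (squareTruncation C fun k => x k ω) (m + 1) ∂P
      = ∫ ω, (η ω : ℂ) * expProduct t (squareTruncation C fun k => x k ω) m ∂P := by
  have hηm : StronglyMeasurable[𝒰 m] fun ω => (η ω : ℂ) :=
    Complex.continuous_ofReal.comp_stronglyMeasurable hη
  have hηa : AEStronglyMeasurable (fun ω => (η ω : ℂ)) P :=
    (hηm.mono (𝒰.le m)).aestronglyMeasurable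
  have hηB : ∀ᵐ ω ∂P, ‖(η ω : ℂ)‖ ≤ B := by
    filter_upwards [hB] with ω hω
    rwa [Complex.norm_real, Real.norm_eq_abs]
  have hI : ∀ l, Integrable
      (fun ω => (η ω : ℂ) * expProduct t (squareTruncation C fun k => x k ω) l) P := fun l =>
    (integrable_expProduct_squareTruncation hx hg hxg t hC l).bdd_mul hηa hηB
  set φ : Ω → ℂ := fun ω => (η ω : ℂ) *
    (expProduct t (squareTruncation C fun k => x k ω) m * ((t : ℂ) * Complex.I)) with hφ
  have hφm : StronglyMeasurable[𝒰 m] φ :=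
    hηm.mul ((measurable_expProduct_squareTruncation hx t C m).stronglyMeasurable.mul
      stronglyMeasurable_const)
  have e : ∀ ω, (η ω : ℂ) * expProduct t (squareTruncation C fun k => x k ω) (m + 1)
      = (η ω : ℂ) * expProduct t (squareTruncation C fun k => x k ω) m
        + squareTruncation C (fun k => x k ω) m • φ ω := by
    intro ω
    rw [expProduct_succ, hφ, Complex.real_smul]
    push_cast
    ring
  obtain ⟨hy, hy0⟩ := condExp_squareTruncation hx hint h0 C m
  have hyφ : Integrable ((fun ω => squareTruncation C (fun k => x k ω) m) • φ) P := by
    refine ((hI (m + 1)).sub (hI m)).congr (ae_of_all _ fun ω => ?_)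
    simp only [Pi.sub_apply, Pi.smul_apply', e ω]
    ring
  have := integral_smul_eq_zero_of_condExp_eq_zero (𝒰.le m) hφm hy hyφ hy0
  have h2 := integral_add (hI m) hyφ
  simp only [Pi.smul_apply'] at h2
  rw [integral_congr_ae (ae_of_all _ e), h2, this, add_zero]

theorem integral_mul_expProduct_of_le [IsProbabilityMeasure P] {x : ℕ → Ω → ℝ}
    (hx : ∀ k, Measurable[𝒰 (k + 1)] (x k))
    (hint : ∀ k, Integrable (x k) P) (h0 : ∀ k, P[x k | 𝒰 k] =ᵐ[P] 0)
    {g : Ω → ℝ} (hg : Integrable g P)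
    (hxg : ∀ᵐ ω ∂P, ∀ k, |x k ω| ≤ g ω) (t : ℝ) {C : ℝ} (hC : 0 ≤ C) {m : ℕ}
    {η : Ω → ℝ} (hη : StronglyMeasurable[𝒰 m] η) {B : ℝ} (hB : ∀ᵐ ω ∂P, |η ω| ≤ B)
    {l : ℕ} (hml : m ≤ l) :
    ∫ ω, (η ω : ℂ) * expProduct t (squareTruncation C fun k => x k ω) l ∂P
      = ∫ ω, (η ω : ℂ) * expProduct t (squareTruncation C fun k => x k ω) m ∂P := by
  induction l, hml using Nat.le_induction with
  | base => rfl
  | succ l hl ih =>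
    rw [← ih]
    exact integral_mul_expProduct_succ hx hint h0 hg hxg t hC (hη.mono (𝒰.mono hl)) hB

/-- The product is measurable for the limit σ-algebra, so `η` may be projected onto it, then onto `𝒰
m` at an L¹ cost. Against a `𝒰 m`-measurable weight the martingale property shortens the product to
its first `m` factors, which are close to 1. Only the means of |η_∞ - η_m| and of `g` enter the
final bound. -/
theorem norm_integral_mul_expProduct_sub_le [IsProbabilityMeasure P] {x : ℕ → Ω → ℝ}
    (hx : ∀ k, Measurable[𝒰 (k + 1)] (x k))
    (hint : ∀ k, Integrable (x k) P) (h0 : ∀ k, P[x k | 𝒰 k] =ᵐ[P] 0)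
    {g : Ω → ℝ} (hg : Integrable g P)
    (hxg : ∀ᵐ ω ∂P, ∀ k, |x k ω| ≤ g ω) (t : ℝ) {C : ℝ} (hC : 0 ≤ C) {m l : ℕ} (hml : m ≤ l)
    {η : Ω → ℝ} (hη : Measurable η) {B : ℝ} (hB : ∀ ω, |η ω| ≤ B) :
    ‖∫ ω, (η ω : ℂ) * expProduct t (squareTruncation C fun k => x k ω) l ∂P
        - ∫ ω, (η ω : ℂ) ∂P‖
      ≤ Real.exp (t ^ 2 * C / 2) *
          (∫ ω, |(P[η | ⨆ n, 𝒰 n]) ω - (P[η | 𝒰 m]) ω| ∂P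
            + (2 * B + m * B) * |t| * ∫ ω, g ω ∂P) := by
  have hB0 : 0 ≤ B := by
    obtain ⟨ω, -⟩ := hxg.exists
    exact (abs_nonneg _).trans (hB ω)
  have hsup : (⨆ n, 𝒰 n) ≤ mΩ := iSup_le 𝒰.le
  set T : ℕ → Ω → ℂ := fun l ω => expProduct t (squareTruncation C fun k => x k ω) l with hT
  set K := Real.exp (t ^ 2 * C / 2) with hK
  have hTm : ∀ l, Measurable[𝒰 l] (T l) := measurable_expProduct_squareTruncation hx t C
  have hTi : ∀ l, Integrable (T l) P := integrable_expProduct_squareTruncation hx hg hxg t hC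
  have hηi : Integrable η P :=
    Integrable.of_bound hη.aestronglyMeasurable B (ae_of_all _ fun ω => hB ω)
  have hbd : ∀ m' : MeasurableSpace Ω, ∀ᵐ ω ∂P, |(P[η | m']) ω| ≤ B := fun m' =>
    ae_bdd_abs_condExp_of_ae_bdd_abs (ae_of_all _ hB)
  have hmulT : ∀ {ζ : Ω → ℝ} (D : ℝ) (j : ℕ), AEStronglyMeasurable ζ P →
      (∀ᵐ ω ∂P, |ζ ω| ≤ D) → Integrable (fun ω => (ζ ω : ℂ) * T j ω) P := by
    intro ζ D j h1 h2
    refine (hTi j).bdd_mul (c := D) (Complex.continuous_ofReal.comp_aestronglyMeasurable h1) ?_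
    filter_upwards [h2] with ω hω
    rwa [Complex.norm_real, Real.norm_eq_abs]
  set ηs := P[η | ⨆ n, 𝒰 n] with hηs
  set ηm := P[η | 𝒰 m] with hηm
  have hsi : Integrable ηs P := integrable_condExp
  have hmi : Integrable ηm P := integrable_condExp
  have hgnn : ∀ᵐ ω ∂P, 0 ≤ g ω := by
    filter_upwards [hxg] with ω hω using (abs_nonneg _).trans (hω 0)
  -- replace `η` by its projection on the limit σ-algebra
  have e1 : ∫ ω, (η ω : ℂ) * T l ω ∂P = ∫ ω, (ηs ω : ℂ) * T l ω ∂P := by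
    have h0' : P[η - ηs | ⨆ n, 𝒰 n] =ᵐ[P] 0 := by
      refine (condExp_sub hηi hsi _).trans ?_
      rw [condExp_of_stronglyMeasurable hsup stronglyMeasurable_condExp hsi]
      simp
    have hI1 := hmulT B l hη.aestronglyMeasurable (ae_of_all _ hB)
    have hI2 := hmulT B l hsi.aestronglyMeasurable (hbd _)
    have h := integral_smul_eq_zero_of_condExp_eq_zero (E := ℂ) hsup
      (φ := T l) ((hTm l).stronglyMeasurable.mono (le_iSup (fun n => 𝒰 n) l)) (hηi.sub hsi)
      (by
        refine (hI1.sub hI2).congr (ae_of_all _ fun ω => ?_)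
        simp only [Pi.sub_apply, Pi.smul_apply', Complex.real_smul]
        push_cast; ring) h0'
    rw [← sub_eq_zero, ← integral_sub hI1 hI2, ← h]
    refine integral_congr_ae (ae_of_all _ fun ω => ?_)
    simp only [Pi.sub_apply, Complex.real_smul]
    push_cast; ring
  have e2 : ∫ ω, (ηm ω : ℂ) * T l ω ∂P = ∫ ω, (ηm ω : ℂ) * T m ω ∂P :=
    integral_mul_expProduct_of_le hx hint h0 hg hxg t hC stronglyMeasurable_condExp (hbd _) hml
  have e3 : ∫ ω, (η ω : ℂ) ∂P = ∫ ω, (ηm ω : ℂ) ∂P := by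
    rw [integral_complex_ofReal, integral_complex_ofReal, hηm, integral_condExp (𝒰.le m)]
  have hI3 := hmulT B l hsi.aestronglyMeasurable (hbd _)
  have hI4 := hmulT B l hmi.aestronglyMeasurable (hbd _)
  have hI5 := hmulT B m hmi.aestronglyMeasurable (hbd _)
  have hI6 : Integrable (fun ω => (ηm ω : ℂ)) P := hmi.ofReal
  have e4 : ∫ ω, (η ω : ℂ) * T l ω ∂P - ∫ ω, (η ω : ℂ) ∂P
      = ∫ ω, ((ηs ω : ℂ) * T l ω - (ηm ω : ℂ) * T l ω) ∂P
        + ∫ ω, ((ηm ω : ℂ) * T m ω - (ηm ω : ℂ)) ∂P := by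
    rw [integral_sub hI3 hI4, integral_sub hI5 hI6, e1, e3, e2]; ring
  have b1 : ‖∫ ω, ((ηs ω : ℂ) * T l ω - (ηm ω : ℂ) * T l ω) ∂P‖
      ≤ ∫ ω, K * (|ηs ω - ηm ω| + 2 * B * |t| * g ω) ∂P := by
    refine norm_integral_le_of_norm_le
      (((hsi.sub hmi).abs.add (hg.const_mul _)).const_mul _) ?_
    filter_upwards [hxg, hgnn, hbd (⨆ n, 𝒰 n), hbd (𝒰 m)] with ω h1 h2 h3 h4
    rw [← sub_mul, norm_mul, ← Complex.ofReal_sub, Complex.norm_real, Real.norm_eq_abs]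
    have h5 : ‖T l ω‖ ≤ K * (1 + |t| * g ω) := norm_expProduct_squareTruncation_le hC h1 l
    -- The crossing factor 1 + |t|g is unbounded; the crude bound 2B on the difference is used only
    -- against its small part |t|g.
    have h6 : |ηs ω - ηm ω| ≤ 2 * B := by
      have := abs_sub (ηs ω) (ηm ω)
      linarith
    calc |ηs ω - ηm ω| * ‖T l ω‖ ≤ |ηs ω - ηm ω| * (K * (1 + |t| * g ω)) :=
          mul_le_mul_of_nonneg_left h5 (abs_nonneg _)
      _ = K * (|ηs ω - ηm ω| + |ηs ω - ηm ω| * (|t| * g ω)) := by ring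
      _ ≤ K * (|ηs ω - ηm ω| + 2 * B * (|t| * g ω)) := by gcongr
      _ = _ := by ring
  have b2 : ‖∫ ω, ((ηm ω : ℂ) * T m ω - (ηm ω : ℂ)) ∂P‖
      ≤ ∫ ω, K * (m * B * |t| * g ω) ∂P := by
    refine norm_integral_le_of_norm_le ((hg.const_mul _).const_mul _) ?_
    filter_upwards [hxg, hgnn, hbd (𝒰 m)] with ω h1 h2 h4
    have h5 : ‖T m ω - 1‖ ≤ m * (|t| * (K * g ω)) :=
      norm_expProduct_squareTruncation_sub_one_le h1 m
    have e : (ηm ω : ℂ) * T m ω - (ηm ω : ℂ) = (ηm ω : ℂ) * (T m ω - 1) := by ring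
    rw [e, norm_mul, Complex.norm_real, Real.norm_eq_abs]
    calc |ηm ω| * ‖T m ω - 1‖ ≤ B * (m * (|t| * (K * g ω))) :=
          mul_le_mul h4 h5 (norm_nonneg _) hB0
      _ = _ := by ring
  have b3 := integral_add (hsi.sub hmi).abs (hg.const_mul (2 * B * |t|))
  simp only [Pi.sub_apply] at b3
  rw [integral_const_mul, b3, integral_const_mul] at b1
  rw [integral_const_mul, integral_const_mul] at b2
  rw [e4]
  refine (norm_add_le _ _).trans ((add_le_add b1 b2).trans (le_of_eq ?_))
  ring

end Row

/-- Since w < C strictly, the truncation is eventually inactive along the path; the cubic error is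
then at most |t|³ g times the sum of squares, and the random exponent may be replaced by its limit.
-/
theorem tendsto_exp_sub_expProduct {x : ℕ → ℕ → ℝ} {g : ℕ → ℝ} {r : ℕ → ℕ} {w C : ℝ}
    (hx : ∀ n k, |x n k| ≤ g n) (hg : Tendsto g atTop (𝓝 0))
    (hq : Tendsto (fun n => ∑ k ∈ Finset.range (r n), x n k ^ 2) atTop (𝓝 w)) (hw : w < C)
    (t : ℝ) :
    Tendsto (fun n => Complex.exp ((t * ∑ k ∈ Finset.range (r n), x n k : ℝ) * Complex.I)
        - expProduct t (squareTruncation C (x n)) (r n) * (Real.exp (-(t ^ 2 * w) / 2) : ℝ))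
      atTop (𝓝 0) := by
  set q : ℕ → ℝ := fun n => ∑ k ∈ Finset.range (r n), x n k ^ 2 with hqdef
  set K := Real.exp (t ^ 2 * C / 2) with hK
  have hC : ∀ᶠ n in atTop, q n ≤ C := (hq.eventually (eventually_lt_nhds hw)).mono fun _ h => h.le
  have hg1 : ∀ᶠ n in atTop, |t| * g n ≤ 1 := by
    have : Tendsto (fun n => |t| * g n) atTop (𝓝 0) := by simpa using hg.const_mul |t|
    exact (this.eventually (eventually_lt_nhds one_pos)).mono fun _ h => h.le
  have hlim : Tendsto (fun n => |t| ^ 3 * g n * q n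
      + K * |Real.exp (-(t ^ 2 * q n) / 2) - Real.exp (-(t ^ 2 * w) / 2)|) atTop (𝓝 0) := by
    have h1 : Tendsto (fun n => |t| ^ 3 * g n * q n) atTop (𝓝 (|t| ^ 3 * 0 * w)) :=
      (hg.const_mul _).mul hq
    have h2 : Tendsto (fun n => K * |Real.exp (-(t ^ 2 * q n) / 2) - Real.exp (-(t ^ 2 * w) / 2)|)
        atTop (𝓝 (K * |Real.exp (-(t ^ 2 * w) / 2) - Real.exp (-(t ^ 2 * w) / 2)|)) := by
      refine Tendsto.const_mul _ (Tendsto.abs (Tendsto.sub_const ?_ _))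
      exact (Real.continuous_exp.tendsto _).comp (((hq.const_mul _).neg).div_const _)
    simpa using h1.add h2
  refine squeeze_zero_norm' ?_ hlim
  filter_upwards [hC, hg1] with n h1 h2
  rw [expProduct_squareTruncation_of_le h1]
  have h3 := norm_exp_sum_sub_expProduct_le t (x n) (g n) (r n) (hx n) h2
  have h4 : ‖expProduct t (x n) (r n)‖ ≤ K := by
    rw [← expProduct_squareTruncation_of_le h1]
    exact norm_expProduct_squareTruncation_le_of_le _ h1
  have e : Complex.exp ((t * ∑ k ∈ Finset.range (r n), x n k : ℝ) * Complex.I)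
        - expProduct t (x n) (r n) * (Real.exp (-(t ^ 2 * w) / 2) : ℝ)
      = (Complex.exp ((t * ∑ k ∈ Finset.range (r n), x n k : ℝ) * Complex.I)
        - expProduct t (x n) (r n) * (Real.exp (-(t ^ 2 * q n) / 2) : ℝ))
        + expProduct t (x n) (r n) *
          ((Real.exp (-(t ^ 2 * q n) / 2) - Real.exp (-(t ^ 2 * w) / 2) : ℝ) : ℂ) := by
    push_cast; ring
  rw [e]
  refine (norm_add_le _ _).trans (add_le_add h3 ?_)
  rw [norm_mul, Complex.norm_real, Real.norm_eq_abs]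
  exact mul_le_mul_of_nonneg_right h4 (abs_nonneg _)

/-! ### Passage to the limit in the transforms, and stable convergence -/

section

variable {Ω : Type*} {mΩ : MeasurableSpace Ω} {P : Measure Ω}

/-- A dominated convergence theorem whose dominating functions vary: ‖f‖ ≤ min(‖f‖, |A|) + g, where
the first part is bounded and the second vanishes in mean. -/
theorem tendsto_integral_norm_zero_of_le_const_add [IsFiniteMeasure P] {E : Type*}
    [NormedAddCommGroup E] {f : ℕ → Ω → E} {g : ℕ → Ω → ℝ} {A : ℝ}
    (hf : ∀ n, AEStronglyMeasurable (f n) P)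
    (hg : ∀ n, Integrable (g n) P) (hg0 : ∀ n, 0 ≤ᵐ[P] g n)
    (hfg : ∀ n, ∀ᵐ ω ∂P, ‖f n ω‖ ≤ A + g n ω)
    (hglim : Tendsto (fun n => ∫ ω, g n ω ∂P) atTop (𝓝 0))
    (hflim : ∀ᵐ ω ∂P, Tendsto (fun n => f n ω) atTop (𝓝 0)) :
    Tendsto (fun n => ∫ ω, ‖f n ω‖ ∂P) atTop (𝓝 0) := by
  have hm : ∀ n, AEStronglyMeasurable (fun ω => min ‖f n ω‖ |A|) P := fun n =>
    (hf n).norm.inf aestronglyMeasurable_const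
  have hb : ∀ n, ∀ᵐ ω ∂P, ‖min ‖f n ω‖ |A|‖ ≤ |A| := fun n => ae_of_all _ fun ω => by
    rw [Real.norm_eq_abs, abs_of_nonneg (le_min (norm_nonneg _) (abs_nonneg _))]
    exact min_le_right _ _
  have h1 : Tendsto (fun n => ∫ ω, min ‖f n ω‖ |A| ∂P) atTop (𝓝 0) := by
    have := tendsto_integral_of_dominated_convergence (fun _ => |A|) hm (integrable_const _) hb
      (f := fun _ => (0 : ℝ)) (by
        filter_upwards [hflim] with ω hω
        have := hω.norm.min (tendsto_const_nhds (x := |A|))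
        rwa [norm_zero, min_eq_left (abs_nonneg A)] at this)
    simpa using this
  have hmi : ∀ n, Integrable (fun ω => min ‖f n ω‖ |A|) P := fun n =>
    Integrable.of_bound (hm n) _ (hb n)
  have h2 : Tendsto (fun n => ∫ ω, min ‖f n ω‖ |A| ∂P + ∫ ω, g n ω ∂P) atTop (𝓝 0) := by
    simpa using h1.add hglim
  refine squeeze_zero (fun n => integral_nonneg fun ω => norm_nonneg _) (fun n => ?_) h2
  rw [← integral_add (hmi n) (hg n)]
  refine integral_mono_of_nonneg (ae_of_all _ fun ω => norm_nonneg _) ((hmi n).add (hg n)) ?_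
  filter_upwards [hfg n, hg0 n] with ω h3 h4
  simp only [Pi.zero_apply] at *
  rcases le_total ‖f n ω‖ |A| with h | h
  · rw [min_eq_left h]; linarith
  · rw [min_eq_right h]; linarith [le_abs_self A]

theorem tendstoInMeasure_of_tendsto_integral [IsFiniteMeasure P] {g : ℕ → Ω → ℝ}
    (hg : ∀ n, Integrable (g n) P) (hg0 : ∀ n, 0 ≤ᵐ[P] g n)
    (hglim : Tendsto (fun n => ∫ ω, g n ω ∂P) atTop (𝓝 0)) :
    TendstoInMeasure P g atTop (fun _ => (0 : ℝ)) := by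
  refine tendstoInMeasure_of_tendsto_eLpNorm (p := 1) one_ne_zero
    (fun n => (hg n).aestronglyMeasurable) aestronglyMeasurable_const ?_
  have : ∀ n, eLpNorm (g n - fun _ => (0 : ℝ)) 1 P = ENNReal.ofReal (∫ ω, g n ω ∂P) := by
    intro n
    have e : (g n - fun _ => (0 : ℝ)) = g n := by ext; simp
    rw [e, eLpNorm_one_eq_lintegral_enorm, ← ofReal_integral_norm_eq_lintegral_enorm (hg n)]
    congr 1
    refine integral_congr_ae ?_
    filter_upwards [hg0 n] with ω hω
    rw [Real.norm_eq_abs, abs_of_nonneg hω]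
  simp_rw [this]
  simpa using ENNReal.tendsto_ofReal hglim

/-- A martingale difference array, with rows dominated by functions that tend to `0` in mean. -/
structure IsDominatedDiffArray (P : Measure Ω) (𝒰 : Filtration ℕ mΩ) (x : ℕ → ℕ → Ω → ℝ)
    (g : ℕ → Ω → ℝ) : Prop where
  measurable : ∀ n k, Measurable[𝒰 (k + 1)] (x n k)
  integrable : ∀ n k, Integrable (x n k) P
  condExp_eq_zero : ∀ n k, P[x n k | 𝒰 k] =ᵐ[P] 0
  integrable_bound : ∀ n, Integrable (g n) P
  le_bound : ∀ n, ∀ᵐ ω ∂P, ∀ k, |x n k ω| ≤ g n ω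
  tendsto_bound : Tendsto (fun n => ∫ ω, g n ω ∂P) atTop (𝓝 0)

variable {𝒰 : Filtration ℕ mΩ} {x : ℕ → ℕ → Ω → ℝ} {g : ℕ → Ω → ℝ}

theorem IsDominatedDiffArray.bound_nonneg (h : IsDominatedDiffArray P 𝒰 x g) (n : ℕ) :
    0 ≤ᵐ[P] g n := by
  filter_upwards [h.le_bound n] with ω hω using (abs_nonneg _).trans (hω 0)

theorem IsDominatedDiffArray.tendsto_integral_mul_expProduct [IsProbabilityMeasure P]
    (h : IsDominatedDiffArray P 𝒰 x g) {r : ℕ → ℕ} (hr : ∀ n, n ≤ r n) (t : ℝ) {C : ℝ}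
    (hC : 0 ≤ C) {η : Ω → ℝ} (hη : Measurable η) {B : ℝ} (hB : ∀ ω, |η ω| ≤ B) :
    Tendsto (fun n => ∫ ω, (η ω : ℂ) *
        expProduct t (squareTruncation C fun k => x n k ω) (r n) ∂P) atTop
      (𝓝 (∫ ω, (η ω : ℂ) ∂P)) := by
  set K := Real.exp (t ^ 2 * C / 2) with hK
  have hL : Tendsto (fun m => ∫ ω, |(P[η | ⨆ n, 𝒰 n]) ω - (P[η | 𝒰 m]) ω| ∂P) atTop (𝓝 0) := by
    have h1 := (ENNReal.tendsto_toReal ENNReal.zero_ne_top).comp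
      (tendsto_eLpNorm_condExp (μ := P) (ℱ := 𝒰) η)
    refine h1.congr fun m => ?_
    rw [Function.comp_apply, eLpNorm_one_eq_lintegral_enorm,
      ← integral_norm_eq_lintegral_enorm
        (integrable_condExp.sub integrable_condExp).aestronglyMeasurable]
    refine integral_congr_ae (ae_of_all _ fun ω => ?_)
    simp only [Pi.sub_apply, Real.norm_eq_abs]
    exact abs_sub_comm _ _
  rw [Metric.tendsto_atTop]
  intro ε hε
  have hKp : 0 < K := Real.exp_pos _
  -- Lévy's upward theorem fixes `m` first; then the row index grows, and r n ≥ n guarantees that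
  -- row n has at least `m` terms.
  obtain ⟨m, hm⟩ := (hL.eventually (eventually_lt_nhds (b := ε / 2 / K) (by positivity))).exists
  have h2 : Tendsto (fun n => K * ((2 * B + m * B) * |t| * ∫ ω, g n ω ∂P)) atTop (𝓝 0) := by
    simpa using (h.tendsto_bound.const_mul ((2 * B + m * B) * |t|)).const_mul K
  obtain ⟨N, hN⟩ := eventually_atTop.1 (h2.eventually (eventually_lt_nhds (half_pos hε)))
  refine ⟨max N m, fun n hn => ?_⟩
  rw [dist_eq_norm]
  refine (norm_integral_mul_expProduct_sub_le (h.measurable n) (h.integrable n)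
    (h.condExp_eq_zero n) (h.integrable_bound n) (h.le_bound n) t hC
    (((le_max_right N m).trans hn).trans (hr n)) hη hB).trans_lt ?_
  have h3 := hN n ((le_max_left N m).trans hn)
  have h4 := mul_lt_mul_of_pos_left hm hKp
  rw [mul_div_cancel₀ _ hKp.ne'] at h4
  rw [mul_add]
  linarith

/-- Apply the limit of the products to the weight ξ exp(-t² W⁺ / 2). Confining ξ to {W < C} allows
one truncation level to serve every relevant path. The positive part keeps the exponential at most 1
everywhere; almost surely W ≥ 0 where it matters. -/
theorem IsDominatedDiffArray.tendsto_integral_exp_of_support [IsProbabilityMeasure P]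
    (h : IsDominatedDiffArray P 𝒰 x g) {r : ℕ → ℕ} (hr : ∀ n, n ≤ r n) {W : Ω → ℝ}
    (hW : Measurable W)
    (hq : TendstoInMeasure P (fun n ω => ∑ k ∈ Finset.range (r n), x n k ω ^ 2) atTop W)
    (t : ℝ) {C : ℝ} (hC : 0 ≤ C) {ξ : Ω → ℝ} (hξ : Measurable ξ) {B : ℝ} (hB : ∀ ω, |ξ ω| ≤ B)
    (hξC : ∀ ω, C ≤ W ω → ξ ω = 0) :
    Tendsto (fun n => ∫ ω, (ξ ω : ℂ) *
        Complex.exp ((t * ∑ k ∈ Finset.range (r n), x n k ω : ℝ) * Complex.I) ∂P) atTop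
      (𝓝 (∫ ω, ((ξ ω * Real.exp (-(t ^ 2 * max (W ω) 0) / 2) : ℝ) : ℂ) ∂P)) := by
  set K := Real.exp (t ^ 2 * C / 2) with hK
  set E : Ω → ℝ := fun ω => Real.exp (-(t ^ 2 * max (W ω) 0) / 2) with hE
  have hE1 : ∀ ω, |E ω| ≤ 1 := fun ω => by
    rw [hE, abs_of_pos (Real.exp_pos _), Real.exp_le_one_iff]
    have : 0 ≤ t ^ 2 * max (W ω) 0 := by positivity
    linarith
  have hEm : Measurable E :=
    Real.measurable_exp.comp (((measurable_const.mul (hW.max measurable_const)).neg).div_const _)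
  have hηB : ∀ ω, |ξ ω * E ω| ≤ B := fun ω => by
    rw [abs_mul]; exact (mul_le_of_le_one_right (abs_nonneg _) (hE1 ω)).trans (hB ω)
  have hηm : Measurable fun ω => ξ ω * E ω := hξ.mul hEm
  set T : ℕ → Ω → ℂ := fun n ω => expProduct t (squareTruncation C fun k => x n k ω) (r n) with hT
  set S : ℕ → Ω → ℂ := fun n ω =>
    Complex.exp ((t * ∑ k ∈ Finset.range (r n), x n k ω : ℝ) * Complex.I) with hS
  have hxm : ∀ n k, Measurable (x n k) := fun n k => (h.measurable n k).mono (𝒰.le _) le_rfl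
  have hSm : ∀ n, Measurable (S n) := fun n => by
    refine Complex.measurable_exp.comp (Measurable.mul_const (Complex.measurable_ofReal.comp ?_) _)
    exact measurable_const.mul (Finset.measurable_sum _ fun k _ => hxm n k)
  have hTi : ∀ n, Integrable (T n) P := fun n => integrable_expProduct_squareTruncation
    (h.measurable n) (h.integrable_bound n) (h.le_bound n) t hC (r n)
  have hS1 : ∀ n ω, ‖S n ω‖ = 1 := fun n ω => Complex.norm_exp_ofReal_mul_I _
  have hI1 : ∀ n, Integrable (fun ω => (ξ ω : ℂ) * S n ω) P := fun n =>
    Integrable.of_bound ((Complex.measurable_ofReal.comp hξ).mul (hSm n)).aestronglyMeasurable B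
      (ae_of_all _ fun ω => by
        rw [norm_mul, hS1, mul_one, Complex.norm_real]; exact hB ω)
  have hI2 : ∀ n, Integrable (fun ω => ((ξ ω * E ω : ℝ) : ℂ) * T n ω) P := fun n =>
    (hTi n).bdd_mul (c := B) (Complex.measurable_ofReal.comp hηm).aestronglyMeasurable
      (ae_of_all _ fun ω => by rw [Complex.norm_real]; exact hηB ω)
  have hmain := h.tendsto_integral_mul_expProduct hr t hC hηm hηB
  -- Bounds and sums of squares converge only in probability; along a further subsequence they
  -- converge almost surely and the pathwise comparison applies.
  refine tendsto_of_subseq_tendsto fun ns hns => ?_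
  have hgM := (tendstoInMeasure_of_tendsto_integral h.integrable_bound h.bound_nonneg
    h.tendsto_bound).comp hns
  obtain ⟨m₁, hm₁, hg₁⟩ := hgM.exists_seq_tendsto_ae
  obtain ⟨m₂, hm₂, hq₂⟩ := ((hq.comp hns).comp hm₁.tendsto_atTop).exists_seq_tendsto_ae
  refine ⟨m₁ ∘ m₂, ?_⟩
  set s : ℕ → ℕ := fun n => ns (m₁ (m₂ n)) with hs
  have hsT : Tendsto s atTop atTop :=
    hns.comp (hm₁.tendsto_atTop.comp hm₂.tendsto_atTop)
  have hB0 : 0 ≤ B := by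
    obtain ⟨ω, -⟩ := (h.le_bound 0).exists
    exact (abs_nonneg _).trans (hB ω)
  have hD : Tendsto (fun n => ∫ ω, ‖(ξ ω : ℂ) * S (s n) ω
      - ((ξ ω * E ω : ℝ) : ℂ) * T (s n) ω‖ ∂P) atTop (𝓝 0) := by
    refine tendsto_integral_norm_zero_of_le_const_add (A := B + B * K)
      (g := fun n ω => B * K * |t| * g (s n) ω)
      (fun n => ((hI1 _).sub (hI2 _)).aestronglyMeasurable)
      (fun n => (h.integrable_bound _).const_mul _) (fun n => ?_) (fun n => ?_) ?_ ?_
    · filter_upwards [h.bound_nonneg (s n)] with ω hω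
      simp only [Pi.zero_apply] at *
      positivity
    · filter_upwards [h.le_bound (s n)] with ω hω
      refine (norm_sub_le _ _).trans ?_
      rw [norm_mul, norm_mul, hS1, mul_one, Complex.norm_real, Complex.norm_real]
      have h1 : ‖T (s n) ω‖ ≤ K * (1 + |t| * g (s n) ω) :=
        norm_expProduct_squareTruncation_le hC hω _
      have h2 := mul_le_mul (hηB ω) h1 (norm_nonneg _) hB0
      have h3 := hB ω
      rw [Real.norm_eq_abs, Real.norm_eq_abs]
      linarith
    · simp_rw [integral_const_mul]
      simpa using (h.tendsto_bound.comp hsT).const_mul (B * K * |t|)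
    · filter_upwards [hg₁, hq₂, ae_all_iff.2 h.le_bound] with ω h1 h2 h3
      by_cases hw : W ω < C
      · have hW0 : 0 ≤ W ω := ge_of_tendsto' h2 fun n =>
          Finset.sum_nonneg (s := Finset.range (r (s n))) fun k _ => sq_nonneg (x (s n) k ω)
        have h4 := tendsto_exp_sub_expProduct (x := fun n k => x (s n) k ω)
          (fun n => h3 (s n)) (h1.comp hm₂.tendsto_atTop) h2 hw t
        have h5 := h4.const_mul (ξ ω : ℂ)
        rw [mul_zero] at h5
        refine h5.congr fun n => ?_
        simp only [hE, max_eq_left hW0, hS, hT]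
        push_cast
        ring
      · simp [hξC ω (not_lt.1 hw)]
  have hD' : Tendsto (fun n => ∫ ω, ((ξ ω : ℂ) * S (s n) ω
      - ((ξ ω * E ω : ℝ) : ℂ) * T (s n) ω) ∂P) atTop (𝓝 0) :=
    squeeze_zero_norm (fun n => norm_integral_le_integral_norm _) hD
  have := hD'.add (hmain.comp hsT)
  rw [zero_add] at this
  refine this.congr fun n => ?_
  rw [integral_sub (hI1 _) (hI2 _)]
  simp only [Function.comp_apply, hT, hs]
  ring

/-- The support condition is removed by cutting ξ off outside {W < N}. The exponentials have modulus
at most 1, so the error is at most E|ξ - ξ_N|, uniformly in the row. -/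
theorem IsDominatedDiffArray.tendsto_integral_exp [IsProbabilityMeasure P]
    (h : IsDominatedDiffArray P 𝒰 x g) {r : ℕ → ℕ} (hr : ∀ n, n ≤ r n) {W : Ω → ℝ}
    (hW : Measurable W)
    (hq : TendstoInMeasure P (fun n ω => ∑ k ∈ Finset.range (r n), x n k ω ^ 2) atTop W)
    (t : ℝ) {ξ : Ω → ℝ} (hξ : Measurable ξ) {B : ℝ} (hB : ∀ ω, |ξ ω| ≤ B) :
    Tendsto (fun n => ∫ ω, (ξ ω : ℂ) *
        Complex.exp ((t * ∑ k ∈ Finset.range (r n), x n k ω : ℝ) * Complex.I) ∂P) atTop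
      (𝓝 (∫ ω, ((ξ ω * Real.exp (-(t ^ 2 * max (W ω) 0) / 2) : ℝ) : ℂ) ∂P)) := by
  set E : Ω → ℝ := fun ω => Real.exp (-(t ^ 2 * max (W ω) 0) / 2) with hE
  have hE1 : ∀ ω, ‖E ω‖ ≤ 1 := fun ω => by
    rw [Real.norm_eq_abs, hE, abs_of_pos (Real.exp_pos _), Real.exp_le_one_iff]
    have : 0 ≤ t ^ 2 * max (W ω) 0 := by positivity
    linarith
  have hEm : Measurable E :=
    Real.measurable_exp.comp (((measurable_const.mul (hW.max measurable_const)).neg).div_const _)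
  set S : ℕ → Ω → ℂ := fun n ω =>
    Complex.exp ((t * ∑ k ∈ Finset.range (r n), x n k ω : ℝ) * Complex.I) with hS
  have hSm : ∀ n, Measurable (S n) := fun n => by
    refine Complex.measurable_exp.comp (Measurable.mul_const (Complex.measurable_ofReal.comp ?_) _)
    exact measurable_const.mul
      (Finset.measurable_sum _ fun k _ => (h.measurable n k).mono (𝒰.le _) le_rfl)
  have hS1 : ∀ n ω, ‖S n ω‖ ≤ 1 := fun n ω => (Complex.norm_exp_ofReal_mul_I _).le
  set ξN : ℕ → Ω → ℝ := fun N => {ω | W ω < N}.indicator ξ with hξN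
  have hξNm : ∀ N, Measurable (ξN N) := fun N =>
    hξ.indicator (measurableSet_lt hW measurable_const)
  have hξNB : ∀ N ω, |ξN N ω| ≤ B := fun N ω => by
    simp only [hξN, Set.indicator]
    split_ifs
    · exact hB ω
    · rw [abs_zero]; exact (abs_nonneg _).trans (hB ω)
  have hint : ∀ {ζ : Ω → ℝ}, Measurable ζ → (∀ ω, |ζ ω| ≤ B) → Integrable ζ P := fun h1 h2 =>
    Integrable.of_bound h1.aestronglyMeasurable B (ae_of_all _ h2)
  have hδ : Tendsto (fun N => ∫ ω, |ξ ω - ξN N ω| ∂P) atTop (𝓝 0) := by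
    have := tendsto_integral_of_dominated_convergence (μ := P) (F := fun N ω => |ξ ω - ξN N ω|)
      (f := fun _ => (0 : ℝ)) (fun _ => 2 * B)
      (fun N => (hξ.sub (hξNm N)).abs.aestronglyMeasurable) (integrable_const _)
      (fun N => ae_of_all _ fun ω => by
        rw [Real.norm_eq_abs, abs_abs]
        have := abs_sub (ξ ω) (ξN N ω)
        linarith [hB ω, hξNB N ω])
      (ae_of_all _ fun ω => by
        refine tendsto_const_nhds.congr' ?_
        obtain ⟨N, hN⟩ := exists_nat_gt (W ω)
        filter_upwards [eventually_ge_atTop N] with M hM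
        have : W ω < M := hN.trans_le (by exact_mod_cast hM)
        simp [hξN, this])
    simpa using this
  have hcomp : ∀ {φ : Ω → ℂ} (N : ℕ), Measurable φ → (∀ ω, ‖φ ω‖ ≤ 1) →
      ‖∫ ω, (ξ ω : ℂ) * φ ω ∂P - ∫ ω, (ξN N ω : ℂ) * φ ω ∂P‖ ≤ ∫ ω, |ξ ω - ξN N ω| ∂P := by
    intro φ N hφ hφ1
    have hi : ∀ {ζ : Ω → ℝ}, Integrable ζ P → Integrable (fun ω => (ζ ω : ℂ) * φ ω) P :=
      fun hζ => Integrable.mul_bdd (c := 1) hζ.ofReal hφ.aestronglyMeasurable (ae_of_all _ hφ1)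
    rw [← integral_sub (hi (hint hξ hB)) (hi (hint (hξNm N) (hξNB N)))]
    refine norm_integral_le_of_norm_le ((hint hξ hB).sub (hint (hξNm N) (hξNB N))).abs
      (ae_of_all _ fun ω => ?_)
    rw [← sub_mul, norm_mul, ← Complex.ofReal_sub, Complex.norm_real, Real.norm_eq_abs]
    exact mul_le_of_le_one_right (abs_nonneg _) (hφ1 ω)
  rw [Metric.tendsto_atTop]
  intro ε hε
  obtain ⟨N, hN⟩ := (hδ.eventually (eventually_lt_nhds (b := ε / 3) (by positivity))).exists
  have hlim := h.tendsto_integral_exp_of_support hr hW hq t (Nat.cast_nonneg N) (hξNm N) (hξNB N)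
    (fun ω hω => by simp [hξN, not_lt.2 hω])
  obtain ⟨M, hM⟩ := Metric.tendsto_atTop.1 hlim (ε / 3) (by positivity)
  refine ⟨M, fun n hn => ?_⟩
  have h1 := hcomp N (hSm n) (hS1 n)
  have h2 := hcomp N (φ := fun ω => (E ω : ℂ)) (Complex.measurable_ofReal.comp hEm)
    (fun ω => by rw [Complex.norm_real]; exact hE1 ω)
  have h3 := hM n hn
  simp only [Complex.ofReal_mul] at h3
  rw [← dist_eq_norm] at h1 h2
  rw [dist_comm] at h2
  have h4 := dist_triangle4 (∫ ω, (ξ ω : ℂ) * S n ω ∂P) (∫ ω, (ξN N ω : ℂ) * S n ω ∂P)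
    (∫ ω, (ξN N ω : ℂ) * (E ω : ℂ) ∂P) (∫ ω, (ξ ω : ℂ) * (E ω : ℂ) ∂P)
  simp only [hS, hE, Complex.ofReal_mul] at h1 h2 h4 ⊢
  linarith

theorem tendsto_integral_mul_exp_of_tendstoInMeasure [IsFiniteMeasure P] {S Y : ℕ → Ω → ℝ}
    (hS : ∀ n, Measurable (S n)) (hY : ∀ n, Measurable (Y n))
    (hSY : TendstoInMeasure P (fun n ω => Y n ω - S n ω) atTop fun _ => (0 : ℝ)) (t : ℝ)
    {ξ : Ω → ℝ} (hξ : Measurable ξ) {B : ℝ} (hB : ∀ ω, |ξ ω| ≤ B) {L : ℂ}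
    (hL : Tendsto (fun n => ∫ ω, (ξ ω : ℂ) * Complex.exp ((t * S n ω : ℝ) * Complex.I) ∂P)
      atTop (𝓝 L)) :
    Tendsto (fun n => ∫ ω, (ξ ω : ℂ) * Complex.exp ((t * Y n ω : ℝ) * Complex.I) ∂P)
      atTop (𝓝 L) := by
  have hm : ∀ {R : Ω → ℝ}, Measurable R →
      Measurable fun ω => (ξ ω : ℂ) * Complex.exp ((t * R ω : ℝ) * Complex.I) := fun hR =>
    (Complex.measurable_ofReal.comp hξ).mul (Complex.measurable_exp.comp
      (Measurable.mul_const (Complex.measurable_ofReal.comp (measurable_const.mul hR)) _))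
  have hb : ∀ (R : Ω → ℝ) ω, ‖(ξ ω : ℂ) * Complex.exp ((t * R ω : ℝ) * Complex.I)‖ ≤ B :=
    fun R ω => by
      rw [norm_mul, Complex.norm_exp_ofReal_mul_I, mul_one, Complex.norm_real]; exact hB ω
  have hi : ∀ {R : Ω → ℝ}, Measurable R →
      Integrable (fun ω => (ξ ω : ℂ) * Complex.exp ((t * R ω : ℝ) * Complex.I)) P := fun hR =>
    Integrable.of_bound (hm hR).aestronglyMeasurable B (ae_of_all _ (hb _))
  refine tendsto_of_subseq_tendsto fun ns hns => ?_
  obtain ⟨ms, hms, hae⟩ := (hSY.comp hns).exists_seq_tendsto_ae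
  refine ⟨ms, ?_⟩
  have hdiff : Tendsto (fun n => ∫ ω, ((ξ ω : ℂ) *
      Complex.exp ((t * Y (ns (ms n)) ω : ℝ) * Complex.I)
      - (ξ ω : ℂ) * Complex.exp ((t * S (ns (ms n)) ω : ℝ) * Complex.I)) ∂P) atTop (𝓝 0) := by
    have := tendsto_integral_of_dominated_convergence (μ := P)
      (F := fun n ω => (ξ ω : ℂ) * Complex.exp ((t * Y (ns (ms n)) ω : ℝ) * Complex.I)
        - (ξ ω : ℂ) * Complex.exp ((t * S (ns (ms n)) ω : ℝ) * Complex.I))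
      (f := fun _ => (0 : ℂ)) (fun _ => B + B)
      (fun n => ((hm (hY _)).sub (hm (hS _))).aestronglyMeasurable) (integrable_const _)
      (fun n => ae_of_all _ fun ω => (norm_sub_le _ _).trans (add_le_add (hb _ ω) (hb _ ω))) ?_
    · simpa using this
    · filter_upwards [hae] with ω hω
      have h1 : Tendsto (fun n => Complex.exp
          ((t * (Y (ns (ms n)) ω - S (ns (ms n)) ω) : ℝ) * Complex.I) - 1) atTop (𝓝 0) := by
        have hc : Continuous fun u : ℝ => Complex.exp ((t * u : ℝ) * Complex.I) - 1 := by fun_prop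
        have := (hc.tendsto 0).comp hω
        simpa [Function.comp_def] using this
      rw [tendsto_zero_iff_norm_tendsto_zero]
      have h2 := h1.norm.const_mul |ξ ω|
      rw [norm_zero, mul_zero] at h2
      refine h2.congr fun n => ?_
      have e : (ξ ω : ℂ) * Complex.exp ((t * Y (ns (ms n)) ω : ℝ) * Complex.I)
          - (ξ ω : ℂ) * Complex.exp ((t * S (ns (ms n)) ω : ℝ) * Complex.I)
          = (ξ ω : ℂ) * (Complex.exp ((t * S (ns (ms n)) ω : ℝ) * Complex.I) *
            (Complex.exp ((t * (Y (ns (ms n)) ω - S (ns (ms n)) ω) : ℝ) * Complex.I) - 1)) := by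
        rw [mul_sub, ← Complex.exp_add, mul_one, ← mul_sub]
        congr 3
        push_cast; ring_nf
      rw [e, norm_mul, norm_mul, Complex.norm_exp_ofReal_mul_I, one_mul, Complex.norm_real,
        Real.norm_eq_abs]
  have := hdiff.add (hL.comp (hns.comp hms.tendsto_atTop))
  rw [zero_add] at this
  refine this.congr fun n => ?_
  rw [integral_sub (hi (hY _)) (hi (hS _))]
  simp only [Function.comp_apply]
  ring

theorem integral_bind_kernel {S E : Type*} [MeasurableSpace S] [NormedAddCommGroup E]
    [NormedSpace ℝ E] (ν : Measure Ω) [IsFiniteMeasure ν] (κ : Kernel Ω S) [IsMarkovKernel κ]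
    {f : S → E} (hf : Integrable f (ν.bind κ)) :
    ∫ y, f y ∂(ν.bind κ) = ∫ ω, ∫ y, f y ∂(κ ω) ∂ν := by
  have e : ν.bind κ = (κ ∘ₖ Kernel.const Unit ν) () := by
    rw [Kernel.comp_apply, Kernel.const_apply]
  rw [e] at hf ⊢
  rw [Kernel.integral_comp hf, Kernel.const_apply]

theorem integral_cond_eq [IsFiniteMeasure P] {E : Type*} [NormedAddCommGroup E] [NormedSpace ℝ E]
    {H : Set Ω} (hH : MeasurableSet H) (f : Ω → E) :
    ∫ ω, f ω ∂(P[|H]) = (P H)⁻¹.toReal • ∫ ω, H.indicator f ω ∂P := by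
  rw [ProbabilityTheory.cond, integral_smul_measure, integral_indicator hH]

/-- With ξ the indicator of H, the hypothesis is convergence of the characteristic functions of Y n
under P(· | H) to that of the Gaussian mixture; Lévy's continuity theorem does the rest. -/
theorem stablyConverges_centeredGaussianKernel_of_tendsto_integral [IsProbabilityMeasure P]
    {Y : ℕ → Ω → ℝ} (hY : ∀ n, Measurable (Y n)) {W : Ω → ℝ} (hW : Measurable W)
    (h : ∀ (t : ℝ) (ξ : Ω → ℝ), Measurable ξ → (∀ ω, |ξ ω| ≤ 1) →
      Tendsto (fun n => ∫ ω, (ξ ω : ℂ) * Complex.exp ((t * Y n ω : ℝ) * Complex.I) ∂P) atTop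
        (𝓝 (∫ ω, ((ξ ω * Real.exp (-(t ^ 2 * max (W ω) 0) / 2) : ℝ) : ℂ) ∂P))) :
    StablyConverges P Y (centeredGaussianKernel W hW) := by
  intro H hH hPH f
  have : IsProbabilityMeasure (P[|H]) := cond_isProbabilityMeasure hPH.ne'
  set ν : Measure Ω := P[|H] with hν
  have hprob : ∀ n, IsProbabilityMeasure (ν.map (Y n)) := fun n =>
    Measure.isProbabilityMeasure_map (hY n).aemeasurable
  set μ : ℕ → ProbabilityMeasure ℝ := fun n => ⟨ν.map (Y n), hprob n⟩ with hμ
  set μ₀ : ProbabilityMeasure ℝ := ⟨ν.bind (centeredGaussianKernel W hW), inferInstance⟩ with hμ₀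
  have hconv : Tendsto μ atTop (𝓝 μ₀) := by
    rw [ProbabilityMeasure.tendsto_iff_tendsto_charFun]
    intro t
    have e1 : ∀ n, charFun (μ n : Measure ℝ) t = (P H)⁻¹.toReal •
        ∫ ω, ((H.indicator (fun _ => (1 : ℝ)) ω : ℝ) : ℂ)
          * Complex.exp ((t * Y n ω : ℝ) * Complex.I) ∂P := by
      intro n
      rw [charFun_apply_real, hμ, ProbabilityMeasure.coe_mk, integral_map (hY n).aemeasurable
        (by fun_prop), hν, integral_cond_eq hH]
      congr 2
      ext ω
      by_cases hω : ω ∈ H <;> simp [hω]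
    have e2 : charFun (μ₀ : Measure ℝ) t = (P H)⁻¹.toReal •
        ∫ ω, ((H.indicator (fun _ => (1 : ℝ)) ω *
          Real.exp (-(t ^ 2 * max (W ω) 0) / 2) : ℝ) : ℂ) ∂P := by
      rw [charFun_apply_real, hμ₀, ProbabilityMeasure.coe_mk, integral_bind_kernel, hν,
        integral_cond_eq hH]
      · congr 2
        ext ω
        by_cases hω : ω ∈ H
        · simp only [hω, Set.indicator_of_mem, one_mul]
          rw [← charFun_apply_real]
          change charFun (gaussianReal 0 (W ω).toNNReal) t = _
          rw [charFun_gaussianReal, Complex.ofReal_exp]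
          congr 1
          rw [Real.coe_toNNReal']
          push_cast
          ring
        · simp [hω]
      · refine Integrable.of_bound (Continuous.aestronglyMeasurable (by fun_prop)) 1
          (ae_of_all _ fun y => ?_)
        rw [← Complex.ofReal_mul, Complex.norm_exp_ofReal_mul_I]
    simp_rw [e1]
    rw [e2]
    refine Tendsto.const_smul (h t _ (measurable_const.indicator hH) fun ω => ?_) _
    by_cases hω : ω ∈ H <;> simp [hω]
  have h1 := (ProbabilityMeasure.tendsto_iff_forall_integral_tendsto.1 hconv) f
  have e1 : ∀ n, ∫ y, f y ∂(μ n : Measure ℝ) = ∫ ω, f (Y n ω) ∂ν := fun n =>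
    integral_map (hY n).aemeasurable f.continuous.aestronglyMeasurable
  have e2 : ∫ y, f y ∂(μ₀ : Measure ℝ) = ∫ ω, (∫ y, f y ∂(centeredGaussianKernel W hW ω)) ∂ν :=
    integral_bind_kernel _ _ (f.integrable _)
  simp_rw [e1] at h1
  rwa [e2] at h1

/-- **Stable central limit theorem for martingale arrays**: rows of length `r n ≥ n`, maximal
increments tending to `0` in mean, sums of squares converging in probability. -/
theorem stablyConverges_of_martingaleDiffArray [IsProbabilityMeasure P]
    (hxm : ∀ n k, Measurable[𝒰 (k + 1)] (x n k)) (hxi : ∀ n k, Integrable (x n k) P)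
    (hx0 : ∀ n k, P[x n k | 𝒰 k] =ᵐ[P] 0)
    (hmax : Tendsto (fun n => ∫⁻ ω, ⨆ k, ‖x n k ω‖ₑ ∂P) atTop (𝓝 0))
    {r : ℕ → ℕ} (hr : ∀ n, n ≤ r n) {W : Ω → ℝ} (hW : Measurable W)
    (hq : TendstoInMeasure P (fun n ω => ∑ k ∈ Finset.range (r n), x n k ω ^ 2) atTop W)
    {Y : ℕ → Ω → ℝ} (hY : ∀ n, Measurable (Y n))
    (hYS : TendstoInMeasure P (fun n ω => Y n ω - ∑ k ∈ Finset.range (r n), x n k ω) atTop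
      fun _ => (0 : ℝ)) :
    StablyConverges P Y (centeredGaussianKernel W hW) := by
  have hxm' : ∀ n k, Measurable (x n k) := fun n k => (hxm n k).mono (𝒰.le _) le_rfl
  have hfin : ∀ᶠ n in atTop, ∫⁻ ω, ⨆ k, ‖x n k ω‖ₑ ∂P < 1 :=
    hmax.eventually (eventually_lt_nhds one_pos)
  -- The mean of the maximal increment may be infinite for finitely many rows; these are dropped by
  -- shifting the row index.
  obtain ⟨N, hN⟩ := eventually_atTop.1 hfin
  have htop : ∀ n, ∫⁻ ω, ⨆ k, ‖x (n + N) k ω‖ₑ ∂P ≠ ⊤ := fun n =>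
    ((hN (n + N) (Nat.le_add_left _ _)).trans ENNReal.one_lt_top).ne
  have hsm : ∀ n, Measurable fun ω => ⨆ k, ‖x n k ω‖ₑ := fun n =>
    Measurable.iSup fun k => (hxm' n k).enorm
  have hlt : ∀ n, ∀ᵐ ω ∂P, ⨆ k, ‖x (n + N) k ω‖ₑ < ⊤ := fun n =>
    ae_lt_top (hsm _) (htop n)
  have hD : IsDominatedDiffArray P 𝒰 (fun n => x (n + N))
      (fun n ω => (⨆ k, ‖x (n + N) k ω‖ₑ).toReal) :=
    { measurable := fun n => hxm _
      integrable := fun n => hxi _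
      condExp_eq_zero := fun n => hx0 _
      integrable_bound := fun n =>
        integrable_toReal_of_lintegral_ne_top (hsm _).aemeasurable (htop n)
      le_bound := fun n => by
        filter_upwards [hlt n] with ω hω k
        have h1 : ‖x (n + N) k ω‖ₑ ≤ ⨆ k, ‖x (n + N) k ω‖ₑ :=
          le_iSup (fun k => ‖x (n + N) k ω‖ₑ) k
        have h2 := ENNReal.toReal_mono hω.ne h1
        rwa [toReal_enorm] at h2
      tendsto_bound := by
        have h1 : ∀ n, ∫ ω, (⨆ k, ‖x (n + N) k ω‖ₑ).toReal ∂P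
            = (∫⁻ ω, ⨆ k, ‖x (n + N) k ω‖ₑ ∂P).toReal := fun n =>
          integral_toReal (hsm _).aemeasurable (hlt n)
        simp_rw [h1]
        exact (ENNReal.tendsto_toReal ENNReal.zero_ne_top).comp
          (hmax.comp (tendsto_add_atTop_nat N)) }
  refine stablyConverges_centeredGaussianKernel_of_tendsto_integral hY hW fun t ξ hξ hB => ?_
  rw [← tendsto_add_atTop_iff_nat N]
  exact tendsto_integral_mul_exp_of_tendstoInMeasure
    (S := fun n ω => ∑ k ∈ Finset.range (r (n + N)), x (n + N) k ω) (Y := fun n => Y (n + N))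
    (fun n => Finset.measurable_sum _ fun k _ => hxm' _ k) (fun n => hY _)
    (hYS.comp (tendsto_add_atTop_nat N)) t hξ hB
    (hD.tendsto_integral_exp (r := fun n => r (n + N))
      (fun n => (Nat.le_add_right _ _).trans (hr _)) hW (hq.comp (tendsto_add_atTop_nat N)) t hξ hB)

end

/-! ### Real sequences -/

theorem one_div_sqrt_succ_le (k : ℕ) : 1 / √((k : ℝ) + 1) ≤ 2 * (√((k : ℝ) + 1) - √k) := by
  have hk : (0 : ℝ) ≤ k := Nat.cast_nonneg k
  have h1 : 0 < √((k : ℝ) + 1) := Real.sqrt_pos.2 (by linarith)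
  have h2 : √(k : ℝ) ≤ √((k : ℝ) + 1) := Real.sqrt_le_sqrt (by linarith)
  have h3 : √((k : ℝ) + 1) ^ 2 = k + 1 := Real.sq_sqrt (by linarith)
  have h4 : √(k : ℝ) ^ 2 = k := Real.sq_sqrt hk
  rw [div_le_iff₀ h1]
  nlinarith [Real.sqrt_nonneg (k : ℝ)]

theorem sqrt_succ_sub_sqrt_le (k : ℕ) : √((k : ℝ) + 1) - √k ≤ 1 / √((k : ℝ) + 1) := by
  have hk : (0 : ℝ) ≤ k := Nat.cast_nonneg k
  have h1 : 0 < √((k : ℝ) + 1) := Real.sqrt_pos.2 (by linarith)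
  have h2 : √(k : ℝ) ≤ √((k : ℝ) + 1) := Real.sqrt_le_sqrt (by linarith)
  have h3 : √((k : ℝ) + 1) ^ 2 = k + 1 := Real.sq_sqrt (by linarith)
  have h4 : √(k : ℝ) ^ 2 = k := Real.sq_sqrt hk
  rw [le_div_iff₀ h1]
  nlinarith [Real.sqrt_nonneg (k : ℝ)]

theorem sum_one_div_sqrt_succ_le (n : ℕ) :
    ∑ k ∈ Finset.range n, 1 / √((k : ℝ) + 1) ≤ 2 * √n := by
  induction n with
  | zero => simp
  | succ n ih =>
    rw [Finset.sum_range_succ]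
    have := one_div_sqrt_succ_le n
    push_cast
    linarith

theorem sqrt_le_sum_one_div_sqrt_succ (n : ℕ) :
    √n ≤ ∑ k ∈ Finset.range n, 1 / √((k : ℝ) + 1) := by
  induction n with
  | zero => simp
  | succ n ih =>
    rw [Finset.sum_range_succ]
    have := sqrt_succ_sub_sqrt_le n
    push_cast
    linarith

theorem tendsto_sqrt_nat_atTop : Tendsto (fun n : ℕ => √(n : ℝ)) atTop atTop :=
  Real.tendsto_sqrt_atTop.comp tendsto_natCast_atTop_atTop

/-- Little-o comparison with 1/√(k+1), whose partial sums lie between √n and 2√n. -/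
theorem tendsto_sum_range_div_sqrt {u : ℕ → ℝ}
    (hu : Tendsto (fun k : ℕ => √((k : ℝ) + 1) * u k) atTop (𝓝 0)) :
    Tendsto (fun n : ℕ => (∑ k ∈ Finset.range n, u k) / √n) atTop (𝓝 0) := by
  have hpos : ∀ k : ℕ, 0 < √((k : ℝ) + 1) := fun k => Real.sqrt_pos.2 (by positivity)
  have h1 : u =o[atTop] fun k : ℕ => 1 / √((k : ℝ) + 1) := by
    rw [Asymptotics.isLittleO_iff_tendsto fun k h => absurd h (one_div_pos.2 (hpos k)).ne']
    refine hu.congr fun k => ?_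
    rw [div_div_eq_mul_div, div_one, mul_comm]
  have h2 := h1.sum_range (fun k => (one_div_pos.2 (hpos k)).le)
    (tendsto_atTop_mono sqrt_le_sum_one_div_sqrt_succ tendsto_sqrt_nat_atTop)
  have h3 : (fun n => ∑ k ∈ Finset.range n, 1 / √((k : ℝ) + 1)) =O[atTop]
      fun n : ℕ => √(n : ℝ) := by
    refine Asymptotics.IsBigO.of_bound 2 (Eventually.of_forall fun n => ?_)
    rw [Real.norm_eq_abs, Real.norm_eq_abs, abs_of_nonneg (Real.sqrt_nonneg _),
      abs_of_nonneg ((Real.sqrt_nonneg _).trans (sqrt_le_sum_one_div_sqrt_succ n))]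
    exact sum_one_div_sqrt_succ_le n
  exact (h2.trans_isBigO h3).tendsto_div_nhds_zero

theorem one_div_mul_sqrt_succ_le {k : ℕ} (hk : 1 ≤ k) :
    1 / (((k : ℝ) + 1) * √((k : ℝ) + 1)) ≤ 2 * (1 / √k - 1 / √((k : ℝ) + 1)) := by
  have hk' : (1 : ℝ) ≤ k := by exact_mod_cast hk
  have h0 : 0 < √(k : ℝ) := Real.sqrt_pos.2 (by linarith)
  have h1 : 0 < √((k : ℝ) + 1) := Real.sqrt_pos.2 (by linarith)
  have h2 : √(k : ℝ) ≤ √((k : ℝ) + 1) := Real.sqrt_le_sqrt (by linarith)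
  have h5 := one_div_sqrt_succ_le k
  have h3 : √((k : ℝ) + 1) * √((k : ℝ) + 1) = k + 1 := Real.mul_self_sqrt (by linarith)
  have e : 1 / √(k : ℝ) - 1 / √((k : ℝ) + 1)
      = (√((k : ℝ) + 1) - √k) / (√k * √((k : ℝ) + 1)) := by
    field_simp
  rw [e, ← mul_div_assoc]
  calc 1 / (((k : ℝ) + 1) * √((k : ℝ) + 1))
      = (1 / √((k : ℝ) + 1)) / (√((k : ℝ) + 1) * √((k : ℝ) + 1)) := by
        rw [h3, div_div, mul_comm]
    _ ≤ (2 * (√((k : ℝ) + 1) - √k)) / (√((k : ℝ) + 1) * √((k : ℝ) + 1)) := by gcongr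
    _ ≤ _ := by
        have : 0 ≤ 2 * (√((k : ℝ) + 1) - √k) := by linarith
        gcongr

theorem sum_Ico_one_div_mul_sqrt_le {n : ℕ} (hn : 1 ≤ n) (m : ℕ) :
    ∑ k ∈ Finset.Ico n m, 1 / (((k : ℝ) + 1) * √((k : ℝ) + 1)) ≤ 2 / √n := by
  rcases le_total m n with h | h
  · rw [Finset.Ico_eq_empty_of_le h, Finset.sum_empty]; positivity
  · suffices H : ∑ k ∈ Finset.Ico n m, 1 / (((k : ℝ) + 1) * √((k : ℝ) + 1))
        ≤ 2 * (1 / √n - 1 / √m) by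
      refine H.trans ?_
      have : (0 : ℝ) ≤ 1 / √m := by positivity
      have e : 2 / √(n : ℝ) = 2 * (1 / √n) := by ring
      rw [e]
      linarith
    induction m, h using Nat.le_induction with
    | base => simp
    | succ m hm ih =>
      rw [Finset.sum_Ico_succ_top hm]
      have := one_div_mul_sqrt_succ_le (hn.trans hm)
      push_cast
      linarith

/-- The tail of ∑ k^{-3/2} from n on is O(n^{-1/2}), uniformly in the upper end of the sum, so `r`
is arbitrary. -/
theorem tendsto_sqrt_mul_sum_Ico {β : ℕ → ℝ} (h0 : ∀ k, 0 ≤ β k)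
    (hβ : Tendsto (fun k : ℕ => ((k : ℝ) + 1) * √((k : ℝ) + 1) * β k) atTop (𝓝 0)) (r : ℕ → ℕ) :
    Tendsto (fun n : ℕ => √n * ∑ k ∈ Finset.Ico n (r n), β k) atTop (𝓝 0) := by
  rw [Metric.tendsto_atTop]
  intro ε hε
  obtain ⟨K, hK⟩ := eventually_atTop.1 (hβ.eventually (eventually_lt_nhds
    (b := ε / 4) (by positivity)))
  refine ⟨max K 1, fun n hn => ?_⟩
  have hn1 : 1 ≤ n := (le_max_right _ _).trans hn
  have hpos : 0 < √(n : ℝ) := Real.sqrt_pos.2 (by exact_mod_cast hn1)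
  have hsum : 0 ≤ ∑ k ∈ Finset.Ico n (r n), β k := Finset.sum_nonneg fun k _ => h0 k
  rw [Real.dist_eq, sub_zero, abs_of_nonneg (by positivity)]
  have h1 : ∑ k ∈ Finset.Ico n (r n), β k ≤ ε / 4 * (2 / √n) := by
    refine le_trans ?_ (mul_le_mul_of_nonneg_left (sum_Ico_one_div_mul_sqrt_le hn1 (r n))
      (by positivity))
    rw [Finset.mul_sum]
    refine Finset.sum_le_sum fun k hk => ?_
    have h2 := (hK k ((le_max_left _ _).trans (hn.trans (Finset.mem_Ico.1 hk).1))).le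
    have h3 : 0 < ((k : ℝ) + 1) * √((k : ℝ) + 1) :=
      mul_pos (by positivity) (Real.sqrt_pos.2 (by positivity))
    rw [mul_one_div, le_div_iff₀ h3, mul_comm]
    exact h2
  calc √n * ∑ k ∈ Finset.Ico n (r n), β k ≤ √n * (ε / 4 * (2 / √n)) := by gcongr
    _ = ε / 2 := by field_simp; norm_num
    _ < ε := half_lt_self hε

theorem summable_of_tendsto_mul_sqrt {β : ℕ → ℝ} (h0 : ∀ k, 0 ≤ β k)
    (hβ : Tendsto (fun k : ℕ => ((k : ℝ) + 1) * √((k : ℝ) + 1) * β k) atTop (𝓝 0)) :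
    Summable β := by
  have hs : Summable fun k : ℕ => 1 / (((k : ℝ) + 1) * √((k : ℝ) + 1)) := by
    have hnn : ∀ k : ℕ, 0 ≤ 1 / (((k : ℝ) + 1) * √((k : ℝ) + 1)) := fun k => by positivity
    refine summable_of_sum_range_le (c := 1 + 2) hnn fun n => ?_
    rcases Nat.eq_zero_or_pos n with rfl | hn
    · simp; norm_num
    · rw [← Finset.sum_range_add_sum_Ico _ hn]
      refine add_le_add (by simp) ?_
      simpa using sum_Ico_one_div_mul_sqrt_le le_rfl n
  refine summable_of_isBigO_nat hs (Asymptotics.IsBigO.of_bound 1 ?_)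
  filter_upwards [hβ.eventually (eventually_lt_nhds one_pos)] with k hk
  have h3 : 0 < ((k : ℝ) + 1) * √((k : ℝ) + 1) :=
    mul_pos (by positivity) (Real.sqrt_pos.2 (by positivity))
  rw [Real.norm_eq_abs, abs_of_nonneg (h0 k), Real.norm_eq_abs,
    abs_of_nonneg (one_div_pos.2 h3).le, one_mul, le_div_iff₀ h3, mul_comm]
  exact hk.le

theorem summable_mul_of_tendsto_pow_three {α : ℕ → ℝ} (h0 : ∀ k, 0 ≤ α k)
    (hα : Tendsto (fun k : ℕ => ((k : ℝ) + 1) ^ 3 * α k) atTop (𝓝 0)) :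
    Summable fun k : ℕ => ((k : ℝ) + 1) * α k := by
  have hs : Summable fun k : ℕ => 1 / ((k : ℝ) + 1) ^ 2 := by
    have := (summable_nat_add_iff 1).2 (Real.summable_one_div_nat_pow.2 one_lt_two)
    simpa using this
  refine summable_of_isBigO_nat hs (Asymptotics.IsBigO.of_bound 1 ?_)
  filter_upwards [hα.eventually (eventually_lt_nhds one_pos)] with k hk
  have hk0 : (0 : ℝ) < (k : ℝ) + 1 := by positivity
  have h1 : 0 ≤ ((k : ℝ) + 1) * α k := mul_nonneg hk0.le (h0 k)
  rw [Real.norm_eq_abs, abs_of_nonneg h1, Real.norm_eq_abs, abs_of_nonneg (by positivity),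
    one_mul, le_div_iff₀ (by positivity)]
  calc ((k : ℝ) + 1) * α k * ((k : ℝ) + 1) ^ 2 = ((k : ℝ) + 1) ^ 3 * α k := by ring
    _ ≤ 1 := hk.le

theorem tendsto_succ_pow_three_mul {α : ℕ → ℝ} (h0 : ∀ k, 0 ≤ α k)
    (hα : Tendsto (fun k : ℕ => (k : ℝ) ^ 3 * α k) atTop (𝓝 0)) :
    Tendsto (fun k : ℕ => ((k : ℝ) + 1) ^ 3 * α k) atTop (𝓝 0) := by
  have h8 : Tendsto (fun k : ℕ => 8 * ((k : ℝ) ^ 3 * α k)) atTop (𝓝 0) := by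
    simpa using hα.const_mul 8
  refine squeeze_zero' (Eventually.of_forall fun k => mul_nonneg (by positivity) (h0 k)) ?_ h8
  filter_upwards [eventually_ge_atTop 1] with k hk
  have hk' : (1 : ℝ) ≤ k := by exact_mod_cast hk
  have : ((k : ℝ) + 1) ^ 3 ≤ (2 * (k : ℝ)) ^ 3 := by gcongr; linarith
  calc ((k : ℝ) + 1) ^ 3 * α k ≤ (2 * (k : ℝ)) ^ 3 * α k := mul_le_mul_of_nonneg_right this (h0 k)
    _ = _ := by ring

/-- **Kronecker's lemma** with weights `k + 1`. -/
theorem tendsto_div_sum_of_tendsto_sum_div {u : ℕ → ℝ} {l : ℝ}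
    (h : Tendsto (fun n => ∑ k ∈ Finset.range n, u k / ((k : ℝ) + 1)) atTop (𝓝 l)) :
    Tendsto (fun n : ℕ => (∑ k ∈ Finset.range n, u k) / n) atTop (𝓝 0) := by
  set s : ℕ → ℝ := fun n => ∑ k ∈ Finset.range n, u k / ((k : ℝ) + 1) with hs
  -- Abel summation: after division by n, the limit is that of s n minus its Cesàro mean.
  have e : ∀ n, ∑ k ∈ Finset.range n, u k = n * s n - ∑ k ∈ Finset.range n, s k := by
    intro n
    induction n with
    | zero => simp
    | succ n ih =>
      rw [Finset.sum_range_succ, ih, Finset.sum_range_succ _ n]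
      have : s (n + 1) = s n + u n / ((n : ℝ) + 1) := Finset.sum_range_succ _ _
      rw [this]
      push_cast
      field_simp
      ring
  have h1 : Tendsto (fun n : ℕ => s n - (n : ℝ)⁻¹ * ∑ k ∈ Finset.range n, s k) atTop
      (𝓝 (l - l)) := h.sub h.cesaro
  rw [sub_self] at h1
  refine h1.congr' ?_
  filter_upwards [eventually_ge_atTop 1] with n hn
  have : (n : ℝ) ≠ 0 := by positivity
  rw [e]
  field_simp

/-! ### Square integrable processes with small drift -/

section

variable {Ω : Type*} {mΩ : MeasurableSpace Ω} {P : Measure Ω} {𝒰 : Filtration ℕ mΩ}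

/-- Pythagoras: f - E(f | m) is orthogonal to E(f | m). -/
theorem integral_sq_eq_integral_sq_condExp_add [IsFiniteMeasure P] {m : MeasurableSpace Ω}
    (hm : m ≤ mΩ) {f : Ω → ℝ} (hf : MemLp f 2 P) :
    ∫ ω, f ω ^ 2 ∂P = ∫ ω, (P[f | m]) ω ^ 2 ∂P + ∫ ω, (f ω - (P[f | m]) ω) ^ 2 ∂P := by
  have hE : MemLp (P[f | m]) 2 P := hf.condExp (by norm_num)
  have hD : MemLp (f - P[f | m]) 2 P := hf.sub hE
  have h0 : P[f - P[f | m] | m] =ᵐ[P] 0 := by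
    refine (condExp_sub (hf.integrable (by norm_num)) integrable_condExp _).trans ?_
    rw [condExp_of_stronglyMeasurable hm stronglyMeasurable_condExp integrable_condExp]
    simp
  have h1 := integral_eq_zero_of_condExp_eq_zero hm stronglyMeasurable_condExp
    (hD.integrable (by norm_num)) (hE.integrable_mul hD) h0
  have e : ∀ ω, f ω ^ 2 = (P[f | m]) ω ^ 2 + (f ω - (P[f | m]) ω) ^ 2
      + 2 * ((P[f | m]) ω * (f - P[f | m]) ω) := fun ω => by
    simp only [Pi.sub_apply]; ring
  have hI := hE.integrable_sq.add hD.integrable_sq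
  have h2 := integral_add hI ((hE.integrable_mul hD).const_mul 2)
  have h3 := integral_add hE.integrable_sq hD.integrable_sq
  simp only [Pi.add_apply, Pi.sub_apply, Pi.mul_apply] at h1 h2 h3 e
  rw [integral_congr_ae (ae_of_all _ e), h2, h3, integral_const_mul, h1]
  ring

theorem integral_sq_condExp_le [IsFiniteMeasure P] {m : MeasurableSpace Ω}
    (hm : m ≤ mΩ) {f : Ω → ℝ} (hf : MemLp f 2 P) :
    ∫ ω, (P[f | m]) ω ^ 2 ∂P ≤ ∫ ω, f ω ^ 2 ∂P := by
  rw [integral_sq_eq_integral_sq_condExp_add hm hf]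
  exact le_add_of_nonneg_right (integral_nonneg fun ω => sq_nonneg _)

theorem integral_sq_sub_condExp_le [IsFiniteMeasure P] {m : MeasurableSpace Ω}
    (hm : m ≤ mΩ) {f : Ω → ℝ} (hf : MemLp f 2 P) :
    ∫ ω, (f ω - (P[f | m]) ω) ^ 2 ∂P ≤ ∫ ω, f ω ^ 2 ∂P := by
  rw [integral_sq_eq_integral_sq_condExp_add hm hf]
  exact le_add_of_nonneg_left (integral_nonneg fun ω => sq_nonneg _)

theorem sq_integral_abs_le_integral_sq [IsProbabilityMeasure P] {f : Ω → ℝ} (hf : MemLp f 2 P) :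
    (∫ ω, |f ω| ∂P) ^ 2 ≤ ∫ ω, f ω ^ 2 ∂P := by
  set c := ∫ ω, |f ω| ∂P with hc
  have hi : Integrable (fun ω => |f ω|) P := (hf.integrable (by norm_num)).abs
  -- The variance of |f| is nonnegative.
  have h1 : 0 ≤ ∫ ω, (|f ω| - c) ^ 2 ∂P := integral_nonneg fun ω => sq_nonneg _
  have e : ∀ ω, (|f ω| - c) ^ 2 = (f ω ^ 2 - 2 * c * |f ω|) + c ^ 2 := fun ω => by
    rw [← sq_abs (f ω)]; ring
  have h2 := integral_add (hf.integrable_sq.sub (hi.const_mul (2 * c)))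
    (integrable_const (μ := P) (c ^ 2))
  have h3 := integral_sub hf.integrable_sq (hi.const_mul (2 * c))
  simp only [Pi.sub_apply] at h2
  rw [integral_congr_ae (ae_of_all _ e), h2, h3, integral_const_mul, integral_const] at h1
  simp only [probReal_univ, one_smul] at h1
  rw [← hc] at h1
  linarith

theorem integral_abs_le_of_integral_sq_le [IsProbabilityMeasure P] {f : Ω → ℝ}
    (hf : MemLp f 2 P) {B : ℝ} (hB : ∫ ω, f ω ^ 2 ∂P ≤ B) : ∫ ω, |f ω| ∂P ≤ 1 + B := by
  have h1 := sq_integral_abs_le_integral_sq hf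
  have h2 : 0 ≤ ∫ ω, |f ω| ∂P := integral_nonneg fun ω => abs_nonneg _
  nlinarith [sq_nonneg (∫ ω, |f ω| ∂P - 1)]

/-- Partial sums of a martingale difference sequence converge almost surely if they are bounded
in mean. -/
theorem ae_exists_tendsto_sum_of_condExp_eq_zero [IsFiniteMeasure P] {d : ℕ → Ω → ℝ}
    (hm : ∀ k, Measurable[𝒰 (k + 1)] (d k)) (hi : ∀ k, Integrable (d k) P)
    (h0 : ∀ k, P[d k | 𝒰 k] =ᵐ[P] 0) {R : ℝ}
    (hR : ∀ n, ∫ ω, |∑ k ∈ Finset.range n, d k ω| ∂P ≤ R) :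
    ∀ᵐ ω ∂P, ∃ c, Tendsto (fun n => ∑ k ∈ Finset.range n, d k ω) atTop (𝓝 c) := by
  have hint : ∀ n, Integrable (fun ω => ∑ k ∈ Finset.range n, d k ω) P := fun n =>
    integrable_finsetSum _ fun k _ => hi k
  have hM : Martingale (fun n ω => ∑ k ∈ Finset.range n, d k ω) 𝒰 P := by
    refine martingale_of_condExp_sub_eq_zero_nat (fun n => ?_) hint fun n => ?_
    · refine Measurable.stronglyMeasurable (Finset.measurable_sum _ fun k hk => ?_)
      exact (hm k).mono (𝒰.mono (by have := Finset.mem_range.1 hk; omega)) le_rfl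
    · have e : ((fun ω => ∑ k ∈ Finset.range (n + 1), d k ω)
          - fun ω => ∑ k ∈ Finset.range n, d k ω) = d n := by
        ext ω
        simp [Finset.sum_range_succ]
      rw [e]
      exact h0 n
  refine hM.submartingale.exists_ae_tendsto_of_bdd (R := R.toNNReal) fun n => ?_
  rw [eLpNorm_one_eq_lintegral_enorm, ← ofReal_integral_norm_eq_lintegral_enorm (hint n)]
  exact ENNReal.ofReal_le_ofReal (hR n)

theorem integral_sq_sum_eq_of_condExp_eq_zero [IsFiniteMeasure P] {d : ℕ → Ω → ℝ}
    (hm : ∀ k, Measurable[𝒰 (k + 1)] (d k)) (hd : ∀ k, MemLp (d k) 2 P)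
    (h0 : ∀ k, P[d k | 𝒰 k] =ᵐ[P] 0) (n : ℕ) :
    ∫ ω, (∑ k ∈ Finset.range n, d k ω) ^ 2 ∂P = ∑ k ∈ Finset.range n, ∫ ω, d k ω ^ 2 ∂P := by
  induction n with
  | zero => simp
  | succ n ih =>
    have hS : MemLp (fun ω => ∑ k ∈ Finset.range n, d k ω) 2 P :=
      memLp_finsetSum _ fun k _ => hd k
    have hSm : StronglyMeasurable[𝒰 n] fun ω => ∑ k ∈ Finset.range n, d k ω := by
      refine Measurable.stronglyMeasurable (Finset.measurable_sum _ fun k hk => ?_)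
      exact (hm k).mono (𝒰.mono (by have := Finset.mem_range.1 hk; omega)) le_rfl
    have hSd : Integrable (fun ω => (∑ k ∈ Finset.range n, d k ω) * d n ω) P :=
      hS.integrable_mul (hd n)
    have h1 := integral_eq_zero_of_condExp_eq_zero (𝒰.le n) hSm
      ((hd n).integrable (by norm_num)) hSd (h0 n)
    have e : ∀ ω, (∑ k ∈ Finset.range (n + 1), d k ω) ^ 2
        = ((∑ k ∈ Finset.range n, d k ω) ^ 2 + d n ω ^ 2)
          + 2 * ((∑ k ∈ Finset.range n, d k ω) * d n ω) := fun ω => by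
      rw [Finset.sum_range_succ]; ring
    have h2 := integral_add hS.integrable_sq (hd n).integrable_sq
    have h3 := integral_add (hS.integrable_sq.add (hd n).integrable_sq) (hSd.const_mul 2)
    simp only [Pi.add_apply] at h3
    rw [integral_congr_ae (ae_of_all _ e), h3, h2, integral_const_mul, h1, ih,
      Finset.sum_range_succ]
    ring

theorem ae_summable_of_summable_integral {f : ℕ → Ω → ℝ} (hf0 : ∀ k ω, 0 ≤ f k ω)
    (hfi : ∀ k, Integrable (f k) P) (hs : Summable fun k => ∫ ω, f k ω ∂P) :
    ∀ᵐ ω ∂P, Summable fun k => f k ω := by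
  have h1 : ∫⁻ ω, ∑' k, ENNReal.ofReal (f k ω) ∂P ≠ ⊤ := by
    rw [lintegral_tsum fun k => (hfi k).aestronglyMeasurable.aemeasurable.ennreal_ofReal]
    simp_rw [← ofReal_integral_eq_lintegral_ofReal (hfi _) (ae_of_all _ (hf0 _))]
    exact hs.tsum_ofReal_ne_top
  have hm : AEMeasurable (fun ω => ∑' k, ENNReal.ofReal (f k ω)) P :=
    AEMeasurable.tsum fun k => (hfi k).aestronglyMeasurable.aemeasurable.ennreal_ofReal
  filter_upwards [ae_lt_top' hm h1] with ω hω
  have := ENNReal.summable_toReal hω.ne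
  refine this.congr fun k => ?_
  rw [ENNReal.toReal_ofReal (hf0 k ω)]

/-- The one-step drift `E(Z_{n+1} ∣ 𝒰_n) - Z_n` of a process. -/
noncomputable def drift (P : Measure Ω) (𝒰 : Filtration ℕ mΩ) (Z : ℕ → Ω → ℝ) (n : ℕ) (ω : Ω) :
    ℝ :=
  (P[Z (n + 1) | 𝒰 n]) ω - Z n ω

/-- The innovation `Z_{n+1} - E(Z_{n+1} ∣ 𝒰_n)` of a process. -/
noncomputable def innovation (P : Measure Ω) (𝒰 : Filtration ℕ mΩ) (Z : ℕ → Ω → ℝ) (n : ℕ)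
    (ω : Ω) : ℝ :=
  Z (n + 1) ω - (P[Z (n + 1) | 𝒰 n]) ω

theorem drift_add_innovation (Z : ℕ → Ω → ℝ) (n : ℕ) (ω : Ω) :
    drift P 𝒰 Z n ω + innovation P 𝒰 Z n ω = Z (n + 1) ω - Z n ω := by
  simp only [drift, innovation]; ring

/-- A square integrable adapted process with drifts of order `o(n^{-3/2})` in mean square. -/
structure IsNearMartingale (P : Measure Ω) (𝒰 : Filtration ℕ mΩ) (Z : ℕ → Ω → ℝ) : Prop where
  measurable : ∀ n, Measurable[𝒰 n] (Z n)
  memLp : ∀ n, MemLp (Z n) 2 P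
  tendsto_drift : Tendsto (fun n : ℕ => ((n : ℝ) + 1) ^ 3 * ∫ ω, drift P 𝒰 Z n ω ^ 2 ∂P)
    atTop (𝓝 0)

namespace IsNearMartingale

variable {Z : ℕ → Ω → ℝ}

theorem measurable_drift (h : IsNearMartingale P 𝒰 Z) (n : ℕ) :
    Measurable[𝒰 n] (drift P 𝒰 Z n) :=
  stronglyMeasurable_condExp.measurable.sub (h.measurable n)

theorem memLp_drift (h : IsNearMartingale P 𝒰 Z) (n : ℕ) : MemLp (drift P 𝒰 Z n) 2 P :=
  ((h.memLp (n + 1)).condExp (by norm_num)).sub (h.memLp n)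

theorem measurable_innovation (h : IsNearMartingale P 𝒰 Z) (n : ℕ) :
    Measurable[𝒰 (n + 1)] (innovation P 𝒰 Z n) :=
  (h.measurable (n + 1)).sub
    (stronglyMeasurable_condExp.measurable.mono (𝒰.mono (Nat.le_succ n)) le_rfl)

theorem memLp_innovation (h : IsNearMartingale P 𝒰 Z) (n : ℕ) :
    MemLp (innovation P 𝒰 Z n) 2 P :=
  (h.memLp (n + 1)).sub ((h.memLp (n + 1)).condExp (by norm_num))

theorem summable_mul_integral_sq_drift (h : IsNearMartingale P 𝒰 Z) :
    Summable fun k : ℕ => ((k : ℝ) + 1) * ∫ ω, drift P 𝒰 Z k ω ^ 2 ∂P :=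
  summable_mul_of_tendsto_pow_three (fun _ => integral_nonneg fun _ => sq_nonneg _) h.tendsto_drift

variable [IsProbabilityMeasure P]

theorem integrable (h : IsNearMartingale P 𝒰 Z) (n : ℕ) : Integrable (Z n) P :=
  (h.memLp n).integrable (by norm_num)

theorem integrable_drift (h : IsNearMartingale P 𝒰 Z) (n : ℕ) : Integrable (drift P 𝒰 Z n) P :=
  (h.memLp_drift n).integrable (by norm_num)

theorem integrable_innovation (h : IsNearMartingale P 𝒰 Z) (n : ℕ) :
    Integrable (innovation P 𝒰 Z n) P :=
  (h.memLp_innovation n).integrable (by norm_num)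

theorem condExp_innovation (h : IsNearMartingale P 𝒰 Z) (n : ℕ) :
    P[innovation P 𝒰 Z n | 𝒰 n] =ᵐ[P] 0 := by
  have : innovation P 𝒰 Z n = Z (n + 1) - P[Z (n + 1) | 𝒰 n] := rfl
  rw [this]
  refine (condExp_sub (h.integrable (n + 1)) integrable_condExp _).trans ?_
  rw [condExp_of_stronglyMeasurable (𝒰.le n) stronglyMeasurable_condExp integrable_condExp]
  simp

theorem tendsto_integral_abs_drift (h : IsNearMartingale P 𝒰 Z) :
    Tendsto (fun k : ℕ => ((k : ℝ) + 1) * √((k : ℝ) + 1) * ∫ ω, |drift P 𝒰 Z k ω| ∂P)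
      atTop (𝓝 0) := by
  have h1 := (Real.continuous_sqrt.tendsto 0).comp h.tendsto_drift
  rw [Real.sqrt_zero] at h1
  refine squeeze_zero (fun k => mul_nonneg (by positivity) (integral_nonneg fun ω => abs_nonneg _))
    (fun k => ?_) h1
  refine Real.le_sqrt_of_sq_le ?_
  have hk : (0 : ℝ) ≤ (k : ℝ) + 1 := by positivity
  rw [mul_pow, mul_pow, Real.sq_sqrt hk, ← pow_succ]
  exact mul_le_mul_of_nonneg_left (sq_integral_abs_le_integral_sq (h.memLp_drift k)) (by positivity)

theorem summable_integral_abs_drift (h : IsNearMartingale P 𝒰 Z) :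
    Summable fun k => ∫ ω, |drift P 𝒰 Z k ω| ∂P :=
  summable_of_tendsto_mul_sqrt (fun _ => integral_nonneg fun _ => abs_nonneg _)
    h.tendsto_integral_abs_drift

theorem tendsto_sum_mul_integral_abs_drift (h : IsNearMartingale P 𝒰 Z) :
    Tendsto (fun n : ℕ => (∑ k ∈ Finset.range n, ((k : ℝ) + 1) * ∫ ω, |drift P 𝒰 Z k ω| ∂P) / √n)
      atTop (𝓝 0) := by
  refine tendsto_sum_range_div_sqrt (h.tendsto_integral_abs_drift.congr fun k => ?_)
  ring

/-- Doob decomposition: the drifts have summable L¹ norms, so their sum converges absolutely almost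
surely, and the sum of the innovations is then an L¹-bounded martingale. -/
theorem exists_measurable_limit (h : IsNearMartingale P 𝒰 Z) {B : ℝ}
    (hB : ∀ n, ∫ ω, Z n ω ^ 2 ∂P ≤ B) :
    ∃ L : Ω → ℝ, Measurable L ∧ ∀ᵐ ω ∂P, Tendsto (fun n => Z n ω) atTop (𝓝 (L ω)) := by
  refine measurable_limit_of_tendsto_metrizable_ae
    (fun n => ((h.measurable n).mono (𝒰.le n) le_rfl).aemeasurable) ?_
  have hsum : ∀ n ω, ∑ k ∈ Finset.range n, innovation P 𝒰 Z k ω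
      = Z n ω - Z 0 ω - ∑ k ∈ Finset.range n, drift P 𝒰 Z k ω := by
    intro n ω
    rw [← Finset.sum_range_sub (fun n => Z n ω) n, ← Finset.sum_sub_distrib]
    refine Finset.sum_congr rfl fun k _ => ?_
    rw [← drift_add_innovation (P := P) (𝒰 := 𝒰)]; ring
  have hZ1 : ∀ n, ∫ ω, |Z n ω| ∂P ≤ 1 + B := fun n =>
    integral_abs_le_of_integral_sq_le (h.memLp n) (hB n)
  have h1 := ae_exists_tendsto_sum_of_condExp_eq_zero h.measurable_innovation
    h.integrable_innovation h.condExp_innovation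
    (R := (1 + B) + (1 + B) + ∑' k, ∫ ω, |drift P 𝒰 Z k ω| ∂P) fun n => by
      have hDi : Integrable (fun ω => ∑ k ∈ Finset.range n, |drift P 𝒰 Z k ω|) P :=
        integrable_finsetSum _ fun k _ => (h.integrable_drift k).abs
      have hb : ∫ ω, |∑ k ∈ Finset.range n, innovation P 𝒰 Z k ω| ∂P
          ≤ ∫ ω, (|Z n ω| + |Z 0 ω| + ∑ k ∈ Finset.range n, |drift P 𝒰 Z k ω|) ∂P := by
        refine integral_mono_of_nonneg (ae_of_all _ fun ω => abs_nonneg _)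
          (((h.integrable n).abs.add (h.integrable 0).abs).add hDi) (ae_of_all _ fun ω => ?_)
        simp only [hsum]
        exact (abs_sub _ _).trans (add_le_add (abs_sub _ _) (Finset.abs_sum_le_sum_abs _ _))
      have h2 := integral_add ((h.integrable n).abs.add (h.integrable 0).abs) hDi
      have h3 := integral_add (h.integrable n).abs (h.integrable 0).abs
      simp only [Pi.add_apply] at h2
      rw [h2, h3, integral_finsetSum _ fun k _ => (h.integrable_drift k).abs] at hb
      refine hb.trans (add_le_add (add_le_add (hZ1 n) (hZ1 0)) ?_)
      exact h.summable_integral_abs_drift.sum_le_tsum _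
        fun k _ => integral_nonneg fun ω => abs_nonneg _
  have h2 := ae_summable_of_summable_integral (fun k ω => abs_nonneg (drift P 𝒰 Z k ω))
    (fun k => (h.integrable_drift k).abs) h.summable_integral_abs_drift
  filter_upwards [h1, h2] with ω ⟨c, hc⟩ hs
  have h3 := (hc.add hs.of_abs.hasSum.tendsto_sum_nat).add_const (Z 0 ω)
  refine ⟨_, h3.congr fun n => ?_⟩
  rw [hsum]; ring

end IsNearMartingale

end

/-! ### Convergence in probability -/

section

variable {Ω : Type*} {mΩ : MeasurableSpace Ω} {P : Measure Ω}

/-- Subsequence principle: an implication between pathwise limits, valid along every subsequence,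
passes to convergence in probability. -/
theorem tendstoInMeasure_of_forall_subseq [IsFiniteMeasure P] {f f' h : ℕ → Ω → ℝ}
    {F F' H : Ω → ℝ} (hf : TendstoInMeasure P f atTop F) (hf' : TendstoInMeasure P f' atTop F')
    (hh : ∀ n, AEStronglyMeasurable (h n) P)
    (himp : ∀ (s : ℕ → ℕ) (ω : Ω), Tendsto s atTop atTop →
      Tendsto (fun n => f (s n) ω) atTop (𝓝 (F ω)) →
      Tendsto (fun n => f' (s n) ω) atTop (𝓝 (F' ω)) →
      Tendsto (fun n => h (s n) ω) atTop (𝓝 (H ω))) :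
    TendstoInMeasure P h atTop H := by
  rw [exists_seq_tendstoInMeasure_atTop_iff hh]
  intro ns hns
  obtain ⟨m₁, hm₁, h₁⟩ := (hf.comp hns.tendsto_atTop).exists_seq_tendsto_ae
  obtain ⟨m₂, hm₂, h₂⟩ :=
    ((hf'.comp hns.tendsto_atTop).comp hm₁.tendsto_atTop).exists_seq_tendsto_ae
  refine ⟨m₁ ∘ m₂, hm₁.comp hm₂, ?_⟩
  filter_upwards [h₁, h₂] with ω hω₁ hω₂
  exact himp (fun n => ns (m₁ (m₂ n))) ω
    (hns.tendsto_atTop.comp (hm₁.tendsto_atTop.comp hm₂.tendsto_atTop))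
    (hω₁.comp hm₂.tendsto_atTop) hω₂

theorem tendstoInMeasure_add [IsFiniteMeasure P] {f f' : ℕ → Ω → ℝ} {F F' : Ω → ℝ}
    (hfm : ∀ n, AEStronglyMeasurable (f n) P) (hfm' : ∀ n, AEStronglyMeasurable (f' n) P)
    (hf : TendstoInMeasure P f atTop F) (hf' : TendstoInMeasure P f' atTop F') :
    TendstoInMeasure P (fun n ω => f n ω + f' n ω) atTop fun ω => F ω + F' ω :=
  tendstoInMeasure_of_forall_subseq hf hf' (fun n => (hfm n).add (hfm' n))
    fun _ _ _ h1 h2 => h1.add h2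

theorem tendstoInMeasure_zero_of_abs_le [IsFiniteMeasure P] {f g : ℕ → Ω → ℝ}
    (hfm : ∀ n, AEStronglyMeasurable (f n) P) (hg : ∀ n, Integrable (g n) P)
    (hfg : ∀ n ω, |f n ω| ≤ g n ω) {b : ℕ → ℝ} (hgb : ∀ n, ∫ ω, g n ω ∂P ≤ b n)
    (hb : Tendsto b atTop (𝓝 0)) :
    TendstoInMeasure P f atTop fun _ => (0 : ℝ) := by
  have hg0 : ∀ n ω, 0 ≤ g n ω := fun n ω => (abs_nonneg _).trans (hfg n ω)
  have h1 : TendstoInMeasure P g atTop fun _ => (0 : ℝ) :=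
    tendstoInMeasure_of_tendsto_integral hg (fun n => ae_of_all _ (hg0 n))
      (squeeze_zero (fun n => integral_nonneg (hg0 n)) hgb hb)
  exact tendstoInMeasure_of_forall_subseq h1 h1 hfm fun s ω _ h2 _ =>
    squeeze_zero_norm (fun n => hfg (s n) ω) h2

theorem tendsto_sum_add_sq {ι : Type*} {u e : ℕ → ι → ℝ} {s : ℕ → Finset ι} {q : ℝ}
    (hu : Tendsto (fun n => ∑ k ∈ s n, u n k ^ 2) atTop (𝓝 q))
    (he : Tendsto (fun n => ∑ k ∈ s n, e n k ^ 2) atTop (𝓝 0)) :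
    Tendsto (fun n => ∑ k ∈ s n, (u n k + e n k) ^ 2) atTop (𝓝 q) := by
  have hue : Tendsto (fun n => ∑ k ∈ s n, u n k * e n k) atTop (𝓝 0) := by
    have h1 : Tendsto (fun n => √((∑ k ∈ s n, u n k ^ 2) * ∑ k ∈ s n, e n k ^ 2)) atTop
        (𝓝 0) := by
      have := (Real.continuous_sqrt.tendsto (q * 0)).comp (hu.mul he)
      rwa [mul_zero, Real.sqrt_zero] at this
    -- By Cauchy–Schwarz the cross term is at most the square root of a convergent times a vanishing
    -- sum of squares.
    refine squeeze_zero_norm (fun n => ?_) h1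
    rw [Real.norm_eq_abs]
    exact Real.abs_le_sqrt (Finset.sum_mul_sq_le_sq_mul_sq _ _ _)
  have h2 := (hu.add (hue.const_mul 2)).add he
  simp only [mul_zero, add_zero] at h2
  refine h2.congr fun n => ?_
  rw [Finset.mul_sum, ← Finset.sum_add_distrib, ← Finset.sum_add_distrib]
  exact Finset.sum_congr rfl fun k _ => by ring

theorem tendstoInMeasure_sum_add_sq [IsFiniteMeasure P] {ι : Type*} {u e : ℕ → ι → Ω → ℝ}
    {s : ℕ → Finset ι} {Q : Ω → ℝ} (hum : ∀ n k, Measurable (u n k))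
    (hem : ∀ n k, Measurable (e n k))
    (hu : TendstoInMeasure P (fun n ω => ∑ k ∈ s n, u n k ω ^ 2) atTop Q)
    (he : TendstoInMeasure P (fun n ω => ∑ k ∈ s n, e n k ω ^ 2) atTop fun _ => (0 : ℝ)) :
    TendstoInMeasure P (fun n ω => ∑ k ∈ s n, (u n k ω + e n k ω) ^ 2) atTop Q :=
  tendstoInMeasure_of_forall_subseq hu he
    (fun n => (Finset.measurable_sum _ fun k _ =>
      ((hum n k).add (hem n k)).pow_const 2).aestronglyMeasurable)
    fun σ ω _ h1 h2 => tendsto_sum_add_sq (u := fun n k => u (σ n) k ω)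
      (e := fun n k => e (σ n) k ω) (s := fun n => s (σ n)) h1 h2

theorem exists_seq_tendstoInMeasure_smul [IsFiniteMeasure P] {f : ℕ → Ω → ℝ} {F : Ω → ℝ}
    (hf : TendstoInMeasure P f atTop F) (c : ℕ → ℝ) (N : ℕ → ℕ) :
    ∃ r : ℕ → ℕ, (∀ n, N n ≤ r n) ∧
      TendstoInMeasure P (fun n ω => c n * (f (r n) ω - F ω)) atTop fun _ => (0 : ℝ) := by
  rw [tendstoInMeasure_iff_norm] at hf
  -- A deviation below this threshold stays below 1/(n+1) after multiplication by c n; adding 1 to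
  -- |c n| allows c n = 0.
  have hε : ∀ n : ℕ, (0 : ℝ) < 1 / (((n : ℝ) + 1) * (|c n| + 1)) := fun n => by positivity
  have hδ : ∀ n : ℕ, (0 : ENNReal) < ((n : ENNReal) + 1)⁻¹ := fun n =>
    ENNReal.inv_pos.2 (ENNReal.add_ne_top.2 ⟨ENNReal.natCast_ne_top n, ENNReal.one_ne_top⟩)
  have H : ∀ n : ℕ, ∃ m, N n ≤ m ∧
      P {ω | 1 / (((n : ℝ) + 1) * (|c n| + 1)) ≤ ‖f m ω - F ω‖} ≤ ((n : ENNReal) + 1)⁻¹ := by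
    intro n
    obtain ⟨m, h1, h2⟩ := ((eventually_ge_atTop (N n)).and
      ((hf _ (hε n)).eventually (eventually_le_nhds (hδ n)))).exists
    exact ⟨m, h1, h2⟩
  choose r hr1 hr2 using H
  refine ⟨r, hr1, ?_⟩
  rw [tendstoInMeasure_iff_norm]
  intro ε hε0
  have hlim : Tendsto (fun n : ℕ => ((n : ENNReal) + 1)⁻¹) atTop (𝓝 0) := by
    have := ENNReal.tendsto_inv_nat_nhds_zero.comp (tendsto_add_atTop_nat 1)
    refine this.congr fun n => ?_
    simp
  refine tendsto_of_tendsto_of_tendsto_of_le_of_le' tendsto_const_nhds hlim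
    (Eventually.of_forall fun _ => zero_le) ?_
  have h3 : Tendsto (fun n : ℕ => 1 / ((n : ℝ) + 1)) atTop (𝓝 0) :=
    tendsto_one_div_add_atTop_nhds_zero_nat
  filter_upwards [h3.eventually (eventually_lt_nhds hε0)] with n hn
  refine (measure_mono fun ω hω => ?_).trans (hr2 n)
  simp only [Set.mem_ofPred_eq, sub_zero, norm_mul, Real.norm_eq_abs] at hω ⊢
  rw [div_le_iff₀ (by positivity)]
  have h4 : 1 / ((n : ℝ) + 1) < |c n| * |f (r n) ω - F ω| := hn.trans_le hω
  rw [div_lt_iff₀ (by positivity)] at h4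
  have h5 : 0 ≤ |f (r n) ω - F ω| * ((n : ℝ) + 1) := by positivity
  nlinarith

/-! ### Maximal increments -/

/-- Large columns are small because of `v`, uniformly in n; the finitely many remaining columns are
small because of `w`. -/
theorem tendsto_iSup_mul_zero {v : ℕ → ENNReal} {w : ℕ → ℕ → ENNReal} (hw1 : ∀ n k, w n k ≤ 1)
    (hw0 : ∀ k, Tendsto (fun n => w n k) atTop (𝓝 0)) (hv : Tendsto v atTop (𝓝 0))
    (hvt : ∀ k, v k ≠ ⊤) :
    Tendsto (fun n => ⨆ k, w n k * v k) atTop (𝓝 0) := by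
  rw [ENNReal.tendsto_nhds_zero]
  intro ε hε
  obtain ⟨K, hK⟩ := eventually_atTop.1 (ENNReal.tendsto_nhds_zero.1 hv ε hε)
  have h1 : ∀ᶠ n in atTop, ∀ k ∈ Finset.range K, w n k * v k ≤ ε := by
    rw [Filter.eventually_all_finset]
    intro k _
    have := ENNReal.Tendsto.mul_const (hw0 k) (Or.inr (hvt k))
    rw [zero_mul] at this
    exact ENNReal.tendsto_nhds_zero.1 this ε hε
  filter_upwards [h1] with n hn
  refine iSup_le fun k => ?_
  by_cases hk : k < K
  · exact hn k (Finset.mem_range.2 hk)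
  · exact (mul_le_of_le_one_left' (hw1 n k)).trans (hK k (not_lt.1 hk))

theorem tendsto_lintegral_iSup_mul_zero {v : ℕ → Ω → ENNReal} {w : ℕ → ℕ → ENNReal}
    (hw1 : ∀ n k, w n k ≤ 1) (hw0 : ∀ k, Tendsto (fun n => w n k) atTop (𝓝 0))
    (hvm : ∀ k, Measurable (v k)) (hv : ∀ᵐ ω ∂P, Tendsto (fun k => v k ω) atTop (𝓝 0))
    (hvi : ∫⁻ ω, ⨆ k, v k ω ∂P ≠ ⊤) :
    Tendsto (fun n => ∫⁻ ω, ⨆ k, w n k * v k ω ∂P) atTop (𝓝 0) := by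
  have hsm : Measurable fun ω => ⨆ k, v k ω := Measurable.iSup hvm
  have := tendsto_lintegral_of_dominated_convergence (μ := P)
    (F := fun n ω => ⨆ k, w n k * v k ω) (f := fun _ => 0) (fun ω => ⨆ k, v k ω)
    (fun n => Measurable.iSup fun k => (hvm k).const_mul _)
    (fun n => ae_of_all _ fun ω => iSup_mono fun k => mul_le_of_le_one_left' (hw1 n k)) hvi ?_
  · simpa using this
  · filter_upwards [hv, ae_lt_top hsm hvi] with ω h1 h2
    exact tendsto_iSup_mul_zero hw1 hw0 h1
      fun k => ((le_iSup (fun k => v k ω) k).trans_lt h2).ne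

/-- The bounded part contributes K/√n. For the other part, the maximum of the ρ_k² over k < n is at
most their sum, whose mean is at most nε. -/
theorem tendsto_lintegral_iSup_div_sqrt [IsProbabilityMeasure P] {D : ℕ → Ω → ℝ}
    (hD : ∀ ε : ℝ, 0 < ε → ∃ K : ℝ, 0 ≤ K ∧ ∀ k, ∃ ρ : Ω → ℝ, MemLp ρ 2 P ∧
      ∫ ω, ρ ω ^ 2 ∂P ≤ ε ∧ ∀ᵐ ω ∂P, |D k ω| ≤ K + |ρ ω|) :
    Tendsto (fun n : ℕ => ∫⁻ ω, ⨆ k, (if k < n then ‖D k ω / √n‖ₑ else 0) ∂P) atTop (𝓝 0) := by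
  rw [ENNReal.tendsto_nhds_zero]
  intro ε' hε'
  obtain ⟨η, hη0, hη⟩ : ∃ η : ℝ, 0 < η ∧ ENNReal.ofReal (3 * η) ≤ ε' := by
    rcases eq_or_ne ε' ⊤ with rfl | htop
    · exact ⟨1, one_pos, le_top⟩
    · refine ⟨ε'.toReal / 3, div_pos (ENNReal.toReal_pos hε'.ne' htop) three_pos, ?_⟩
      rw [mul_div_cancel₀ _ three_ne_zero, ENNReal.ofReal_toReal htop]
  obtain ⟨K, hK0, hK⟩ := hD (η ^ 2) (by positivity)
  choose ρ hρ1 hρ2 hρ3 using hK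
  have hKn : Tendsto (fun n : ℕ => K / √(n : ℝ)) atTop (𝓝 0) :=
    tendsto_const_nhds.div_atTop tendsto_sqrt_nat_atTop
  filter_upwards [hKn.eventually (eventually_lt_nhds hη0), eventually_ge_atTop 1] with n hn hn1
  have hn0 : (0 : ℝ) < n := by exact_mod_cast hn1
  have hs0 : 0 < √(n : ℝ) := Real.sqrt_pos.2 hn0
  have hsq : √(n : ℝ) ^ 2 = n := Real.sq_sqrt hn0.le
  -- From a ≤ η + a²/η with a = |ρ|/√n; the second η absorbs K/√n. Since E ρ² ≤ η², the quotient has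
  -- mean at most η, hence 3η in total.
  set G : Ω → ℝ := fun ω => 2 * η + (∑ j ∈ Finset.range n, ρ j ω ^ 2) / (n * η) with hG
  have hG0 : ∀ ω, 0 ≤ G ω := fun ω => by
    have : 0 ≤ ∑ j ∈ Finset.range n, ρ j ω ^ 2 := Finset.sum_nonneg fun j _ => sq_nonneg _
    rw [hG]; positivity
  have hSi : Integrable (fun ω => ∑ j ∈ Finset.range n, ρ j ω ^ 2) P :=
    integrable_finsetSum _ fun j _ => (hρ1 j).integrable_sq
  have hGi : Integrable G P := (integrable_const _).add (hSi.div_const _)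
  have hGint : ∫ ω, G ω ∂P ≤ 3 * η := by
    have h1 := integral_add (integrable_const (μ := P) (2 * η)) (hSi.div_const (n * η))
    rw [hG, h1, integral_const, integral_div,
      integral_finsetSum _ fun j _ => (hρ1 j).integrable_sq]
    have h2 : ∑ j ∈ Finset.range n, ∫ ω, ρ j ω ^ 2 ∂P ≤ n * η ^ 2 := by
      refine (Finset.sum_le_sum fun j _ => hρ2 j).trans (le_of_eq ?_)
      simp
    have h3 : (∑ j ∈ Finset.range n, ∫ ω, ρ j ω ^ 2 ∂P) / (n * η) ≤ η := by
      rw [div_le_iff₀ (by positivity)]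
      calc _ ≤ n * η ^ 2 := h2
        _ = η * (n * η) := by ring
    simp only [probReal_univ, one_smul]
    linarith
  calc ∫⁻ ω, ⨆ k, (if k < n then ‖D k ω / √n‖ₑ else 0) ∂P
      ≤ ∫⁻ ω, ENNReal.ofReal (G ω) ∂P := by
        refine lintegral_mono_ae ?_
        filter_upwards [ae_all_iff.2 hρ3] with ω hω
        refine iSup_le fun k => ?_
        split_ifs with hk
        · rw [← ofReal_norm]
          refine ENNReal.ofReal_le_ofReal ?_
          rw [norm_div, Real.norm_eq_abs, Real.norm_eq_abs, abs_of_pos hs0]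
          have h1 : ρ k ω ^ 2 ≤ ∑ j ∈ Finset.range n, ρ j ω ^ 2 :=
            Finset.single_le_sum (f := fun j => ρ j ω ^ 2) (fun j _ => sq_nonneg _)
              (Finset.mem_range.2 hk)
          have h2 : |ρ k ω| / √n ≤ η + ρ k ω ^ 2 / (n * η) := by
            have h3 : 0 ≤ (|ρ k ω| / √n - η) ^ 2 + |ρ k ω| / √n * η := by positivity
            have h4 : (|ρ k ω| / √n) ^ 2 = ρ k ω ^ 2 / n := by rw [div_pow, sq_abs, hsq]
            have h5 : |ρ k ω| / √n * η ≤ (η + ρ k ω ^ 2 / (n * η)) * η := by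
              have h6 : (η + ρ k ω ^ 2 / (n * η)) * η = η ^ 2 + ρ k ω ^ 2 / n := by
                field_simp
              rw [h6]
              nlinarith
            exact le_of_mul_le_mul_right h5 hη0
          calc |D k ω| / √n ≤ (K + |ρ k ω|) / √n := by gcongr; exact hω k
            _ = K / √n + |ρ k ω| / √n := add_div _ _ _
            _ ≤ η + (η + ρ k ω ^ 2 / (n * η)) := add_le_add hn.le h2
            _ ≤ η + (η + (∑ j ∈ Finset.range n, ρ j ω ^ 2) / (n * η)) := by gcongr
            _ = G ω := by rw [hG]; ring
        · exact zero_le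
    _ = ENNReal.ofReal (∫ ω, G ω ∂P) :=
        (ofReal_integral_eq_lintegral_ofReal hGi (ae_of_all _ hG0)).symm
    _ ≤ ENNReal.ofReal (3 * η) := ENNReal.ofReal_le_ofReal hGint
    _ ≤ ε' := hη

/-- Split f at the level f² = C. The low part and its conditional expectation are each at most √C;
the high part is uniformly small in L², and centering does not increase its L² norm. -/
theorem UniformIntegrable.exists_sub_condExp_le [IsProbabilityMeasure P] {f : ℕ → Ω → ℝ}
    {m : ℕ → MeasurableSpace Ω} (hm : ∀ k, m k ≤ mΩ) (hfm : ∀ k, Measurable (f k))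
    (hf2 : ∀ k, MemLp (f k) 2 P)
    (hf : UniformIntegrable (fun k ω => f k ω ^ 2) 1 P) {ε : ℝ} (hε : 0 < ε) :
    ∃ K : ℝ, 0 ≤ K ∧ ∀ k, ∃ ρ : Ω → ℝ, MemLp ρ 2 P ∧ ∫ ω, ρ ω ^ 2 ∂P ≤ ε ∧
      ∀ᵐ ω ∂P, |f k ω - (P[f k | m k]) ω| ≤ K + |ρ ω| := by
  obtain ⟨C, hC⟩ := hf.spec one_ne_zero ENNReal.one_ne_top hε
  refine ⟨2 * √(C : ℝ), by positivity, fun k => ?_⟩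
  set s : Set Ω := {ω | C ≤ ‖f k ω ^ 2‖₊} with hs
  have hsm : MeasurableSet s :=
    measurableSet_le measurable_const ((hfm k).pow_const 2).nnnorm
  set τ : Ω → ℝ := s.indicator (f k) with hτ
  have hτ2 : MemLp τ 2 P := (hf2 k).indicator hsm
  set b : Ω → ℝ := f k - τ with hb
  have hb2 : MemLp b 2 P := (hf2 k).sub hτ2
  have hbC : ∀ ω, |b ω| ≤ √(C : ℝ) := fun ω => by
    simp only [hb, hτ, Pi.sub_apply, Set.indicator]
    split_ifs with h
    · simp
    · rw [sub_zero]
      refine Real.abs_le_sqrt ?_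
      have h1 : ‖f k ω ^ 2‖₊ < C := not_le.1 h
      have h2 : ‖f k ω ^ 2‖ < (C : ℝ) := by exact_mod_cast h1
      rw [Real.norm_eq_abs, abs_of_nonneg (sq_nonneg _)] at h2
      exact h2.le
  have hτε : ∫ ω, τ ω ^ 2 ∂P ≤ ε := by
    have h1 := hC k
    have e : (fun ω => τ ω ^ 2) = s.indicator (fun ω => f k ω ^ 2) := by
      ext ω
      by_cases h : ω ∈ s <;> simp [hτ, h]
    rw [← hs, ← e, eLpNorm_one_eq_lintegral_enorm,
      ← ofReal_integral_norm_eq_lintegral_enorm hτ2.integrable_sq,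
      ENNReal.ofReal_le_ofReal_iff hε.le] at h1
    simpa using h1
  refine ⟨fun ω => τ ω - (P[τ | m k]) ω, hτ2.sub (hτ2.condExp (by norm_num)),
    (integral_sq_sub_condExp_le (hm k) hτ2).trans hτε, ?_⟩
  have e1 : P[f k | m k] =ᵐ[P] P[b | m k] + P[τ | m k] := by
    have : f k = b + τ := by rw [hb]; simp
    conv_lhs => rw [this]
    exact condExp_add (hb2.integrable (by norm_num)) (hτ2.integrable (by norm_num)) _
  filter_upwards [e1, ae_bdd_abs_condExp_of_ae_bdd_abs (m := m k) (μ := P) (ae_of_all _ hbC)]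
    with ω h1 h2
  have e2 : f k ω - (P[f k | m k]) ω
      = (b ω - (P[b | m k]) ω) + (τ ω - (P[τ | m k]) ω) := by
    rw [h1, hb]
    simp only [Pi.add_apply, Pi.sub_apply]
    ring
  rw [e2]
  refine (abs_add_le _ _).trans (add_le_add ((abs_sub _ _).trans ?_) le_rfl)
  linarith [hbC ω]

end

/-! ### Tails of a convergent series -/

theorem sum_Ico_eq_tsum_sub_tsum {s : ℕ → ℝ} (hs : Summable s) {n m : ℕ} (hnm : n ≤ m) :
    ∑ k ∈ Finset.Ico n m, s k = ∑' i, s (n + i) - ∑' i, s (m + i) := by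
  have h1 := hs.sum_add_tsum_nat_add n
  have h2 := hs.sum_add_tsum_nat_add m
  have h3 := Finset.sum_range_add_sum_Ico s hnm
  simp_rw [add_comm _ n] at h1
  simp_rw [add_comm _ m] at h2
  linarith

/-- The discarded tail beyond r n is of order 1/r n, hence invisible after multiplication by n as
soon as r n grows like n². -/
theorem tendsto_mul_sum_Ico_of_tendsto_tsum {s : ℕ → ℝ} (hs : Summable s) {v : ℝ}
    (hv : Tendsto (fun n : ℕ => ((n : ℝ) + 1) * ∑' i, s (n + i)) atTop (𝓝 v)) {r : ℕ → ℕ}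
    (hr : ∀ n, n ^ 2 + n ≤ r n) :
    Tendsto (fun n : ℕ => (n : ℝ) * ∑ k ∈ Finset.Ico n (r n), s k) atTop (𝓝 v) := by
  have hnr : ∀ n, n ≤ r n := fun n => (Nat.le_add_left n (n ^ 2)).trans (hr n)
  have hrT : Tendsto r atTop atTop := tendsto_atTop_mono hnr tendsto_id
  have h1 : Tendsto (fun n : ℕ => (n : ℝ) / ((n : ℝ) + 1)) atTop (𝓝 1) :=
    tendsto_natCast_div_add_atTop 1
  have h2 : Tendsto (fun n : ℕ => (n : ℝ) / ((r n : ℝ) + 1)) atTop (𝓝 0) := by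
    refine squeeze_zero (fun n => by positivity) (fun n => ?_)
      tendsto_one_div_add_atTop_nhds_zero_nat
    rw [div_le_div_iff₀ (by positivity) (by positivity)]
    have : ((n : ℝ) ^ 2 + n) ≤ r n := by exact_mod_cast hr n
    nlinarith
  have h3 := (h1.mul hv).sub (h2.mul (hv.comp hrT))
  simp only [one_mul, zero_mul, sub_zero] at h3
  refine h3.congr fun n => ?_
  rw [sum_Ico_eq_tsum_sub_tsum hs (hnr n), Function.comp_apply]
  have : (n : ℝ) + 1 ≠ 0 := by positivity
  have : (r n : ℝ) + 1 ≠ 0 := by positivity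
  field_simp

/-- With tails tₙ, (n+1)sₙ = (n+1)tₙ - (n+2)t_{n+1} + t_{n+1}, and the first two terms have the same
limit. -/
theorem tendsto_succ_mul_of_tendsto_tsum {s : ℕ → ℝ} (hs : Summable s) {v : ℝ}
    (hv : Tendsto (fun n : ℕ => ((n : ℝ) + 1) * ∑' i, s (n + i)) atTop (𝓝 v)) :
    Tendsto (fun n : ℕ => ((n : ℝ) + 1) * s n) atTop (𝓝 0) := by
  have h0 : Tendsto (fun n => ∑' i, s (n + 1 + i)) atTop (𝓝 0) := by
    have := (tendsto_sum_nat_add s).comp (tendsto_add_atTop_nat 1)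
    refine this.congr fun n => ?_
    simp only [Function.comp_apply, add_comm]
  have h1 := (hv.sub (hv.comp (tendsto_add_atTop_nat 1))).add h0
  rw [sub_self, zero_add] at h1
  refine h1.congr fun n => ?_
  have h2 := sum_Ico_eq_tsum_sub_tsum hs (Nat.le_succ n)
  rw [Nat.succ_eq_add_one, Nat.Ico_succ_singleton, Finset.sum_singleton] at h2
  rw [h2, Function.comp_apply]
  push_cast
  ring

theorem sum_Icc_one_eq_sum_range (f : ℕ → ℝ) (n : ℕ) :
    ∑ i ∈ Finset.Icc 1 n, f i = ∑ k ∈ Finset.range n, f (k + 1) := by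
  induction n with
  | zero => simp
  | succ n ih => rw [Finset.sum_Icc_succ_top (by omega), ih, Finset.sum_range_succ]

/-! ### The predictors -/

section

variable {Ω : Type*} {mΩ : MeasurableSpace Ω} {P : Measure Ω} {𝒰 : Filtration ℕ mΩ}

/-- The weights of the one-step changes of the predictor in the `n`-th row. -/
noncomputable def rowWeight (n k : ℕ) : ℝ := if k < n then ((k : ℝ) + 1) / √n else √n

/-- The weights of the errors of the predictor in the `n`-th row. -/
noncomputable def rowCutoff (n k : ℕ) : ℝ := if k < n then 1 / √n else 0

/-- The array of martingale differences that governs `√n (X̄ₙ - Zₙ)` and `√n (X̄ₙ - Z)`. -/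
noncomputable def diffArray (P : Measure Ω) (𝒰 : Filtration ℕ mΩ) (X : ℕ → Ω → ℝ) (n k : ℕ)
    (ω : Ω) : ℝ :=
  rowCutoff n k * (X (k + 1) ω - predictor P 𝒰 X k ω)
    - rowWeight n k * innovation P 𝒰 (predictor P 𝒰 X) k ω

/-- The standing assumptions on the sequence `X`. -/
structure IsPredictableSequence (P : Measure Ω) (𝒰 : Filtration ℕ mΩ) (X : ℕ → Ω → ℝ) : Prop where
  measurable : ∀ k, Measurable[𝒰 (k + 1)] (X (k + 1))
  uniformIntegrable : UniformIntegrable (fun (n : ℕ) ω => (X (n + 1) ω) ^ 2) 1 P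
  tendsto_drift : Tendsto (fun n : ℕ => (n : ℝ) ^ 3 *
    ∫ ω, drift P 𝒰 (predictor P 𝒰 X) n ω ^ 2 ∂P) atTop (𝓝 0)

namespace IsPredictableSequence

variable {X : ℕ → Ω → ℝ}

theorem measurable' (h : IsPredictableSequence P 𝒰 X) (k : ℕ) : Measurable (X (k + 1)) :=
  (h.measurable k).mono (𝒰.le _) le_rfl

theorem memLp (h : IsPredictableSequence P 𝒰 X) (k : ℕ) : MemLp (X (k + 1)) 2 P :=
  (memLp_two_iff_integrable_sq (h.measurable' k).aestronglyMeasurable).2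
    (memLp_one_iff_integrable.1 (h.uniformIntegrable.memLp k))

theorem exists_integral_sq_le (h : IsPredictableSequence P 𝒰 X) :
    ∃ B : ℝ, 0 ≤ B ∧ ∀ k, ∫ ω, X (k + 1) ω ^ 2 ∂P ≤ B := by
  obtain ⟨C, hC⟩ := h.uniformIntegrable.2.2
  refine ⟨C, C.2, fun k => ?_⟩
  have h1 := hC k
  rw [eLpNorm_one_eq_lintegral_enorm,
    ← ofReal_integral_norm_eq_lintegral_enorm (h.memLp k).integrable_sq] at h1
  have h2 := ENNReal.toReal_mono ENNReal.coe_ne_top h1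
  rw [ENNReal.toReal_ofReal (integral_nonneg fun ω => norm_nonneg _)] at h2
  simpa using h2

theorem isNearMartingale (h : IsPredictableSequence P 𝒰 X) :
    IsNearMartingale P 𝒰 (predictor P 𝒰 X) where
  measurable n := stronglyMeasurable_condExp.measurable
  memLp n := (h.memLp n).condExp (by norm_num)
  tendsto_drift := tendsto_succ_pow_three_mul (fun n => integral_nonneg fun ω => sq_nonneg _)
    h.tendsto_drift

theorem measurable_sub_predictor (h : IsPredictableSequence P 𝒰 X) (k : ℕ) :
    Measurable[𝒰 (k + 1)] fun ω => X (k + 1) ω - predictor P 𝒰 X k ω :=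
  (h.measurable k).sub ((h.isNearMartingale.measurable k).mono (𝒰.mono (Nat.le_succ k)) le_rfl)

theorem memLp_sub_predictor (h : IsPredictableSequence P 𝒰 X) (k : ℕ) :
    MemLp (fun ω => X (k + 1) ω - predictor P 𝒰 X k ω) 2 P :=
  (h.memLp k).sub (h.isNearMartingale.memLp k)

theorem measurable_diffArray (h : IsPredictableSequence P 𝒰 X) (n k : ℕ) :
    Measurable[𝒰 (k + 1)] (diffArray P 𝒰 X n k) :=
  ((h.measurable_sub_predictor k).const_mul _).sub
    ((h.isNearMartingale.measurable_innovation k).const_mul _)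

variable [IsProbabilityMeasure P]

theorem exists_limit (h : IsPredictableSequence P 𝒰 X) :
    ∃ L : Ω → ℝ, Measurable L ∧
      ∀ᵐ ω ∂P, Tendsto (fun n => predictor P 𝒰 X n ω) atTop (𝓝 (L ω)) := by
  obtain ⟨B, -, hB⟩ := h.exists_integral_sq_le
  exact h.isNearMartingale.exists_measurable_limit
    fun n => (integral_sq_condExp_le (𝒰.le n) (h.memLp n)).trans (hB n)

theorem condExp_sub_predictor (h : IsPredictableSequence P 𝒰 X) (k : ℕ) :
    P[fun ω => X (k + 1) ω - predictor P 𝒰 X k ω | 𝒰 k] =ᵐ[P] 0 := by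
  have e : (fun ω => X (k + 1) ω - predictor P 𝒰 X k ω) = X (k + 1) - predictor P 𝒰 X k := rfl
  rw [e]
  refine (condExp_sub ((h.memLp k).integrable (by norm_num)) (h.isNearMartingale.integrable k)
    _).trans ?_
  rw [condExp_of_stronglyMeasurable (𝒰.le k)
    (h.isNearMartingale.measurable k).stronglyMeasurable (h.isNearMartingale.integrable k)]
  change P[X (k + 1) | 𝒰 k] - P[X (k + 1) | 𝒰 k] =ᵐ[P] 0
  simp

/-- X̄ₙ is the Cesàro mean of the predictors plus that of the prediction errors. The errors, divided
by k+1, sum to an L²-bounded martingale, and Kronecker's lemma applies. -/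
theorem tendsto_sampleMean (h : IsPredictableSequence P 𝒰 X) {L : Ω → ℝ}
    (hL : ∀ᵐ ω ∂P, Tendsto (fun n => predictor P 𝒰 X n ω) atTop (𝓝 (L ω))) :
    ∀ᵐ ω ∂P, Tendsto (fun n => sampleMean X n ω) atTop (𝓝 (L ω)) := by
  obtain ⟨B, hB0, hB⟩ := h.exists_integral_sq_le
  set d : ℕ → Ω → ℝ := fun k ω =>
    (((k : ℝ) + 1)⁻¹) * (X (k + 1) ω - predictor P 𝒰 X k ω) with hd
  have hdm : ∀ k, Measurable[𝒰 (k + 1)] (d k) := fun k =>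
    (h.measurable_sub_predictor k).const_mul _
  have hd2 : ∀ k, MemLp (d k) 2 P := fun k => (h.memLp_sub_predictor k).const_mul _
  have hd0 : ∀ k, P[d k | 𝒰 k] =ᵐ[P] 0 := fun k => by
    refine (condExp_smul (((k : ℝ) + 1)⁻¹)
      (fun ω => X (k + 1) ω - predictor P 𝒰 X k ω) (𝒰 k)).trans ?_
    filter_upwards [h.condExp_sub_predictor k] with ω hω
    simp [hω]
  have hs : Summable fun k : ℕ => B * (1 / ((k : ℝ) + 1) ^ 2) := by
    have := (summable_nat_add_iff 1).2 (Real.summable_one_div_nat_pow.2 one_lt_two)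
    exact (by simpa using this : Summable fun k : ℕ => 1 / ((k : ℝ) + 1) ^ 2).mul_left B
  have hdB : ∀ k, ∫ ω, d k ω ^ 2 ∂P ≤ B * (1 / ((k : ℝ) + 1) ^ 2) := fun k => by
    simp only [hd, mul_pow]
    rw [integral_const_mul, inv_pow, mul_comm, one_div]
    refine mul_le_mul_of_nonneg_right ?_ (by positivity)
    exact (integral_sq_sub_condExp_le (𝒰.le k) (h.memLp k)).trans (hB k)
  have h1 := ae_exists_tendsto_sum_of_condExp_eq_zero hdm
    (fun k => (hd2 k).integrable (by norm_num)) hd0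
    (R := 1 + ∑' k : ℕ, B * (1 / ((k : ℝ) + 1) ^ 2)) fun n => by
      refine integral_abs_le_of_integral_sq_le (memLp_finsetSum _ fun k _ => hd2 k) ?_
      rw [integral_sq_sum_eq_of_condExp_eq_zero hdm hd2 hd0]
      exact (Finset.sum_le_sum fun k _ => hdB k).trans
        (hs.sum_le_tsum _ fun k _ => by positivity)
  filter_upwards [h1, hL] with ω ⟨c, hc⟩ hω
  have h2 : Tendsto (fun n : ℕ => (∑ k ∈ Finset.range n,
      (X (k + 1) ω - predictor P 𝒰 X k ω)) / n) atTop (𝓝 0) := by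
    refine tendsto_div_sum_of_tendsto_sum_div (l := c) (hc.congr fun n => ?_)
    refine Finset.sum_congr rfl fun k _ => ?_
    simp only [hd]
    rw [div_eq_mul_inv, mul_comm]
  have h3 := h2.add hω.cesaro
  rw [zero_add] at h3
  refine h3.congr fun n => ?_
  rw [sampleMean, sum_Icc_one_eq_sum_range (fun i => X i ω), Finset.sum_sub_distrib]
  ring

theorem integrable_diffArray (h : IsPredictableSequence P 𝒰 X) (n k : ℕ) :
    Integrable (diffArray P 𝒰 X n k) P :=
  (((h.memLp_sub_predictor k).integrable (by norm_num)).const_mul _).sub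
    ((h.isNearMartingale.integrable_innovation k).const_mul _)

theorem condExp_diffArray (h : IsPredictableSequence P 𝒰 X) (n k : ℕ) :
    P[diffArray P 𝒰 X n k | 𝒰 k] =ᵐ[P] 0 := by
  have e : diffArray P 𝒰 X n k
      = rowCutoff n k • (fun ω => X (k + 1) ω - predictor P 𝒰 X k ω)
        - rowWeight n k • innovation P 𝒰 (predictor P 𝒰 X) k := rfl
  rw [e]
  refine (condExp_sub (((h.memLp_sub_predictor k).integrable (by norm_num)).smul _)
    ((h.isNearMartingale.integrable_innovation k).smul _) _).trans ?_
  filter_upwards [h.condExp_sub_predictor k, h.isNearMartingale.condExp_innovation k,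
    condExp_smul (μ := P) (rowCutoff n k) (fun ω => X (k + 1) ω - predictor P 𝒰 X k ω) (𝒰 k),
    condExp_smul (μ := P) (rowWeight n k) (innovation P 𝒰 (predictor P 𝒰 X) k) (𝒰 k)]
    with ω h1 h2 h3 h4
  simp [h1, h2, h3, h4]

end IsPredictableSequence

end

/-! ### Row weights: negligible drifts and small maximal increments -/

section

variable {Ω : Type*} {mΩ : MeasurableSpace Ω} {P : Measure Ω} {𝒰 : Filtration ℕ mΩ}

theorem rowWeight_nonneg (n k : ℕ) : 0 ≤ rowWeight n k := by
  rw [rowWeight]; split_ifs <;> positivity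

/-- Every weight is at most √(k+1), the normalization in (jj), so a single integrable supremum
dominates all the rows. -/
theorem enorm_rowWeight_div_le (n k : ℕ) : ‖rowWeight n k / √((k : ℝ) + 1)‖ₑ ≤ 1 := by
  have h1 : 0 < √((k : ℝ) + 1) := Real.sqrt_pos.2 (by positivity)
  have h2 : √((k : ℝ) + 1) * √((k : ℝ) + 1) = k + 1 := Real.mul_self_sqrt (by positivity)
  rw [← ofReal_norm, ENNReal.ofReal_le_one, Real.norm_eq_abs,
    abs_of_nonneg (div_nonneg (rowWeight_nonneg n k) h1.le), div_le_one h1, rowWeight]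
  split_ifs with h
  · have h3 : √((k : ℝ) + 1) ≤ √(n : ℝ) := Real.sqrt_le_sqrt (by exact_mod_cast h)
    rw [div_le_iff₀ (h1.trans_le h3)]
    nlinarith
  · exact Real.sqrt_le_sqrt (by
      have : (n : ℝ) ≤ k := by exact_mod_cast not_lt.1 h
      linarith)

theorem tendsto_enorm_rowWeight_div (k : ℕ) :
    Tendsto (fun n => ‖rowWeight n k / √((k : ℝ) + 1)‖ₑ) atTop (𝓝 0) := by
  have h1 : Tendsto (fun n : ℕ => ((k : ℝ) + 1) / √(n : ℝ) / √((k : ℝ) + 1)) atTop (𝓝 0) := by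
    have := (tendsto_const_nhds (x := (k : ℝ) + 1)).div_atTop tendsto_sqrt_nat_atTop
    simpa using this.div_const (√((k : ℝ) + 1))
  have h2 := h1.enorm
  rw [enorm_zero] at h2
  refine h2.congr' ?_
  filter_upwards [eventually_gt_atTop k] with n hn
  rw [rowWeight, if_pos hn]

theorem enorm_le_one_add_ofReal_sq (x : ℝ) : ‖x‖ₑ ≤ 1 + ENNReal.ofReal (x ^ 2) := by
  rw [← ofReal_norm, ← ENNReal.ofReal_one, ← ENNReal.ofReal_add zero_le_one (sq_nonneg x)]
  refine ENNReal.ofReal_le_ofReal ?_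
  rw [Real.norm_eq_abs, ← sq_abs]
  nlinarith [sq_nonneg (|x| - 1), abs_nonneg x]

/-- `∫ ∑_{k ∈ s} (c_k a_k)²`, for the drifts `a_k`, is the weighted sum of their second moments. -/
theorem IsNearMartingale.integral_sum_sq_drift {Z : ℕ → Ω → ℝ} (h : IsNearMartingale P 𝒰 Z)
    (c : ℕ → ℝ) (s : Finset ℕ) :
    Integrable (fun ω => ∑ k ∈ s, (c k * drift P 𝒰 Z k ω) ^ 2) P ∧
      ∫ ω, ∑ k ∈ s, (c k * drift P 𝒰 Z k ω) ^ 2 ∂P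
        = ∑ k ∈ s, c k ^ 2 * ∫ ω, drift P 𝒰 Z k ω ^ 2 ∂P := by
  have hi : ∀ k ∈ s, Integrable (fun ω => (c k * drift P 𝒰 Z k ω) ^ 2) P := fun k _ => by
    simp_rw [mul_pow]
    exact (h.memLp_drift k).integrable_sq.const_mul _
  refine ⟨integrable_finsetSum _ hi, ?_⟩
  rw [integral_finsetSum _ hi]
  refine Finset.sum_congr rfl fun k _ => ?_
  simp_rw [mul_pow]
  rw [integral_const_mul]

theorem sum_range_rowWeight (f : ℕ → ℝ) (n : ℕ) :
    ∑ k ∈ Finset.range n, rowWeight n k * f k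
      = (∑ k ∈ Finset.range n, ((k : ℝ) + 1) * f k) / √n := by
  rw [Finset.sum_div]
  refine Finset.sum_congr rfl fun k hk => ?_
  rw [rowWeight, if_pos (Finset.mem_range.1 hk)]
  ring

theorem sum_Ico_rowWeight (f : ℕ → ℝ) (n m : ℕ) :
    ∑ k ∈ Finset.Ico n m, rowWeight n k * f k = √n * ∑ k ∈ Finset.Ico n m, f k := by
  rw [Finset.mul_sum]
  refine Finset.sum_congr rfl fun k hk => ?_
  rw [rowWeight, if_neg (not_lt.2 (Finset.mem_Ico.1 hk).1)]

theorem sum_range_rowWeight_sq (f : ℕ → ℝ) (n : ℕ) :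
    ∑ k ∈ Finset.range n, rowWeight n k ^ 2 * f k
      = (n : ℝ)⁻¹ * ∑ k ∈ Finset.range n, ((k : ℝ) + 1) ^ 2 * f k := by
  rw [Finset.mul_sum]
  refine Finset.sum_congr rfl fun k hk => ?_
  rw [rowWeight, if_pos (Finset.mem_range.1 hk), div_pow, Real.sq_sqrt (Nat.cast_nonneg n)]
  ring

theorem sum_Ico_rowWeight_sq (f : ℕ → ℝ) (n m : ℕ) :
    ∑ k ∈ Finset.Ico n m, rowWeight n k ^ 2 * f k = n * ∑ k ∈ Finset.Ico n m, f k := by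
  rw [Finset.mul_sum]
  refine Finset.sum_congr rfl fun k hk => ?_
  rw [rowWeight, if_neg (not_lt.2 (Finset.mem_Ico.1 hk).1), Real.sq_sqrt (Nat.cast_nonneg n)]

/-- Below n this is a Cesàro mean of a null sequence. From n on, the weight n is at most k+1, which
leaves the tail of a convergent series. -/
theorem IsNearMartingale.tendsto_sum_rowWeight_sq {Z : ℕ → Ω → ℝ} (h : IsNearMartingale P 𝒰 Z)
    {r : ℕ → ℕ} (hr : ∀ n, n ≤ r n) :
    Tendsto (fun n => ∑ k ∈ Finset.range (r n), rowWeight n k ^ 2 *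
      ∫ ω, drift P 𝒰 Z k ω ^ 2 ∂P) atTop (𝓝 0) := by
  set α : ℕ → ℝ := fun k => ∫ ω, drift P 𝒰 Z k ω ^ 2 ∂P with hα
  have hα0 : ∀ k, 0 ≤ α k := fun k => integral_nonneg fun ω => sq_nonneg _
  have h1 : Tendsto (fun n : ℕ => (n : ℝ)⁻¹ * ∑ k ∈ Finset.range n, ((k : ℝ) + 1) ^ 2 * α k)
      atTop (𝓝 0) := by
    refine Tendsto.cesaro (squeeze_zero (fun k => mul_nonneg (by positivity) (hα0 k))
      (fun k => ?_) h.tendsto_drift)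
    refine mul_le_mul_of_nonneg_right ?_ (hα0 k)
    exact pow_le_pow_right₀ (by linarith [Nat.cast_nonneg (α := ℝ) k]) (by norm_num)
  have hs := h.summable_mul_integral_sq_drift
  have h2 : Tendsto (fun n : ℕ => n * ∑ k ∈ Finset.Ico n (r n), α k) atTop (𝓝 0) := by
    refine squeeze_zero (fun n => mul_nonneg (Nat.cast_nonneg n)
      (Finset.sum_nonneg fun k _ => hα0 k)) (fun n => ?_)
      (tendsto_sum_nat_add fun k : ℕ => ((k : ℝ) + 1) * α k)
    have h3 : (n : ℝ) * ∑ k ∈ Finset.Ico n (r n), α k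
        ≤ ∑ k ∈ Finset.Ico n (r n), ((k : ℝ) + 1) * α k := by
      rw [Finset.mul_sum]
      refine Finset.sum_le_sum fun k hk => mul_le_mul_of_nonneg_right ?_ (hα0 k)
      have : (n : ℝ) ≤ k := by exact_mod_cast (Finset.mem_Ico.1 hk).1
      linarith
    refine h3.trans ?_
    rw [sum_Ico_eq_tsum_sub_tsum hs (hr n)]
    have h4 : 0 ≤ ∑' i : ℕ, ((((r n + i : ℕ) : ℝ)) + 1) * α (r n + i) :=
      tsum_nonneg fun i => mul_nonneg (by positivity) (hα0 _)
    have h5 : ∑' i : ℕ, ((((n + i : ℕ) : ℝ)) + 1) * α (n + i)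
        = ∑' i : ℕ, ((((i + n : ℕ) : ℝ)) + 1) * α (i + n) := by
      simp_rw [add_comm n]
    linarith
  have h3 := h1.add h2
  rw [add_zero] at h3
  refine h3.congr fun n => ?_
  rw [← Finset.sum_range_add_sum_Ico _ (hr n), sum_range_rowWeight_sq, sum_Ico_rowWeight_sq]

theorem IsNearMartingale.tendsto_sum_rowWeight [IsProbabilityMeasure P] {Z : ℕ → Ω → ℝ}
    (h : IsNearMartingale P 𝒰 Z) {r : ℕ → ℕ} (hr : ∀ n, n ≤ r n) :
    Tendsto (fun n => ∑ k ∈ Finset.range (r n), rowWeight n k *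
      ∫ ω, |drift P 𝒰 Z k ω| ∂P) atTop (𝓝 0) := by
  have h3 := h.tendsto_sum_mul_integral_abs_drift.add
    (tendsto_sqrt_mul_sum_Ico (fun k => integral_nonneg fun ω => abs_nonneg _)
      h.tendsto_integral_abs_drift r)
  rw [add_zero] at h3
  refine h3.congr fun n => ?_
  rw [← Finset.sum_range_add_sum_Ico _ (hr n), sum_range_rowWeight, sum_Ico_rowWeight]

namespace IsPredictableSequence

variable [IsProbabilityMeasure P] {X : ℕ → Ω → ℝ}

/-- For the innovation part, (jv) and (j) make √(k+1) times the innovation vanish pathwise, (jj) and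
(j) make its supremum integrable, and the weights vanish in each fixed column. -/
theorem tendsto_lintegral_iSup_diffArray (h : IsPredictableSequence P 𝒰 X) {V : Ω → ℝ}
    (hsup : IncrementSupIntegrable P (predictor P 𝒰 X))
    (hV : TailSquaresTendsto P (predictor P 𝒰 X) V) :
    Tendsto (fun n => ∫⁻ ω, ⨆ k, ‖diffArray P 𝒰 X n k ω‖ₑ ∂P) atTop (𝓝 0) := by
  have hZ := h.isNearMartingale
  set Z := predictor P 𝒰 X with hZdef
  set v : ℕ → Ω → ENNReal := fun k ω => ‖√((k : ℝ) + 1) * innovation P 𝒰 Z k ω‖ₑ with hv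
  have hvm : ∀ k, Measurable (v k) := fun k =>
    (((hZ.measurable_innovation k).mono (𝒰.le _) le_rfl).const_mul _).enorm
  have hdm : ∀ k, Measurable (drift P 𝒰 Z k) := fun k =>
    (hZ.measurable_drift k).mono (𝒰.le _) le_rfl
  have hai : ∀ k : ℕ, Integrable (fun ω => ((k : ℝ) + 1) * drift P 𝒰 Z k ω ^ 2) P := fun k =>
    (hZ.memLp_drift k).integrable_sq.const_mul _
  have hasum : Summable fun k : ℕ => ∫ ω, ((k : ℝ) + 1) * drift P 𝒰 Z k ω ^ 2 ∂P := by
    simp_rw [integral_const_mul]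
    exact hZ.summable_mul_integral_sq_drift
  have hsq : ∀ k : ℕ, √((k : ℝ) + 1) ^ 2 = k + 1 := fun k => Real.sq_sqrt (by positivity)
  have hinn : ∀ k ω, innovation P 𝒰 Z k ω = -(Z k ω - Z (k + 1) ω) - drift P 𝒰 Z k ω :=
    fun k ω => by
      have := drift_add_innovation (P := P) (𝒰 := 𝒰) Z k ω
      linarith
  have hvlim : ∀ᵐ ω ∂P, Tendsto (fun k => v k ω) atTop (𝓝 0) := by
    filter_upwards [hV, ae_summable_of_summable_integral
      (fun k ω => mul_nonneg (by positivity) (sq_nonneg (drift P 𝒰 Z k ω))) hai hasum]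
      with ω ⟨h1, h2⟩ h3
    have h4 := tendsto_succ_mul_of_tendsto_tsum h1 h2
    have h5 := (h4.add h3.tendsto_atTop_zero).const_mul 2
    rw [add_zero, mul_zero] at h5
    have h6 := (Real.continuous_sqrt.tendsto 0).comp h5
    rw [Real.sqrt_zero] at h6
    have h7 : Tendsto (fun k : ℕ => √((k : ℝ) + 1) * innovation P 𝒰 Z k ω) atTop (𝓝 0) := by
      refine squeeze_zero_norm (fun k => ?_) h6
      rw [Real.norm_eq_abs]
      refine Real.abs_le_sqrt ?_
      rw [mul_pow, hsq, hinn]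
      dsimp only
      rw [← mul_add, mul_left_comm]
      refine mul_le_mul_of_nonneg_left ?_ (by positivity)
      -- (a + b)² ≤ 2(a² + b²), with a the increment and b the drift.
      nlinarith [sq_nonneg ((Z k ω - Z (k + 1) ω) - drift P 𝒰 Z k ω)]
    have h8 := h7.enorm
    rwa [enorm_zero] at h8
  have hvi : ∫⁻ ω, ⨆ k, v k ω ∂P ≠ ⊤ := by
    -- The drift part uses |x| ≤ 1 + x² and bounds a supremum by a sum, which (j) makes integrable.
    have hb : ∀ ω, ⨆ k, v k ω
        ≤ (⨆ i : ℕ, ENNReal.ofReal (√((i : ℝ) + 1) * |Z i ω - Z (i + 1) ω|))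
          + (1 + ∑' k : ℕ, ENNReal.ofReal (((k : ℝ) + 1) * drift P 𝒰 Z k ω ^ 2)) := by
      intro ω
      refine iSup_le fun k => ?_
      have e : √((k : ℝ) + 1) * innovation P 𝒰 Z k ω
          = -(√((k : ℝ) + 1) * (Z k ω - Z (k + 1) ω)) - √((k : ℝ) + 1) * drift P 𝒰 Z k ω := by
        rw [hinn]; ring
      simp only [hv]
      rw [e]
      refine enorm_sub_le.trans (add_le_add ?_ ?_)
      · rw [enorm_neg, ← ofReal_norm, norm_mul, Real.norm_eq_abs, Real.norm_eq_abs,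
          abs_of_nonneg (Real.sqrt_nonneg _)]
        exact le_iSup (fun i : ℕ => ENNReal.ofReal (√((i : ℝ) + 1) * |Z i ω - Z (i + 1) ω|)) k
      · refine (enorm_le_one_add_ofReal_sq _).trans (add_le_add le_rfl ?_)
        rw [mul_pow, hsq]
        exact ENNReal.le_tsum k
    have hm2 : ∀ k : ℕ, Measurable
        fun ω => ENNReal.ofReal (((k : ℝ) + 1) * drift P 𝒰 Z k ω ^ 2) := fun k =>
      (((hdm k).pow_const 2).const_mul _).ennreal_ofReal
    refine ne_top_of_le_ne_top ?_ (lintegral_mono hb)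
    have hm3 : Measurable fun ω => (1 : ENNReal)
        + ∑' k : ℕ, ENNReal.ofReal (((k : ℝ) + 1) * drift P 𝒰 Z k ω ^ 2) :=
      measurable_const.add (Measurable.tsum hm2)
    rw [lintegral_add_right _ hm3, lintegral_add_left measurable_const, lintegral_const, measure_univ, mul_one,
      lintegral_tsum fun k => (hm2 k).aemeasurable]
    have hl : ∀ k : ℕ, ∫⁻ ω, ENNReal.ofReal (((k : ℝ) + 1) * drift P 𝒰 Z k ω ^ 2) ∂P
        = ENNReal.ofReal (∫ ω, ((k : ℝ) + 1) * drift P 𝒰 Z k ω ^ 2 ∂P) := fun k =>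
      (ofReal_integral_eq_lintegral_ofReal (hai k)
        (ae_of_all _ fun ω => mul_nonneg (by positivity) (sq_nonneg _))).symm
    simp_rw [hl]
    exact ENNReal.add_ne_top.2 ⟨hsup.ne, ENNReal.add_ne_top.2
      ⟨ENNReal.one_ne_top, hasum.tsum_ofReal_ne_top⟩⟩
  have h1 := tendsto_lintegral_iSup_mul_zero (P := P) enorm_rowWeight_div_le
    tendsto_enorm_rowWeight_div hvm hvlim hvi
  have h2 := tendsto_lintegral_iSup_div_sqrt (P := P)
    (D := fun k ω => X (k + 1) ω - Z k ω) fun ε hε =>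
      UniformIntegrable.exists_sub_condExp_le (m := fun k => 𝒰 k) 𝒰.le h.measurable' h.memLp
        h.uniformIntegrable hε
  have h3 := h2.add h1
  rw [add_zero] at h3
  refine tendsto_of_tendsto_of_tendsto_of_le_of_le tendsto_const_nhds h3
    (fun _ => zero_le) fun n => ?_
  have hm1 : Measurable fun ω => ⨆ k, ‖rowWeight n k / √((k : ℝ) + 1)‖ₑ * v k ω :=
    Measurable.iSup fun k => (hvm k).const_mul _
  simp only
  rw [← lintegral_add_right _ hm1]
  refine lintegral_mono fun ω => iSup_le fun k => ?_
  have e : rowWeight n k * innovation P 𝒰 Z k ω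
      = (rowWeight n k / √((k : ℝ) + 1)) * (√((k : ℝ) + 1) * innovation P 𝒰 Z k ω) := by
    have : √((k : ℝ) + 1) ≠ 0 := (Real.sqrt_pos.2 (by positivity)).ne'
    field_simp
  rw [diffArray, ← hZdef, e]
  refine enorm_sub_le.trans (add_le_add ?_ ?_)
  · refine le_trans (le_of_eq ?_)
      (le_iSup (fun k => if k < n then ‖(X (k + 1) ω - Z k ω) / √n‖ₑ else 0) k)
    rw [rowCutoff]
    split_ifs
    · congr 1; ring
    · simp
  · rw [enorm_mul]
    exact le_iSup (fun k => ‖rowWeight n k / √((k : ℝ) + 1)‖ₑ * v k ω) k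

end IsPredictableSequence

end

/-! ### Telescoping identities and assembly of the two limits -/

section

variable {Ω : Type*} {mΩ : MeasurableSpace Ω} {P : Measure Ω} {𝒰 : Filtration ℕ mΩ}

/-- The part of `diffArray` that is a function of `X` and its predictors alone. -/
noncomputable def uncenteredArray (P : Measure Ω) (𝒰 : Filtration ℕ mΩ) (X : ℕ → Ω → ℝ)
    (n k : ℕ) (ω : Ω) : ℝ :=
  rowCutoff n k * (X (k + 1) ω - predictor P 𝒰 X k ω)
    + rowWeight n k * (predictor P 𝒰 X k ω - predictor P 𝒰 X (k + 1) ω)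

theorem diffArray_eq (X : ℕ → Ω → ℝ) (n k : ℕ) (ω : Ω) :
    diffArray P 𝒰 X n k ω
      = uncenteredArray P 𝒰 X n k ω + rowWeight n k * drift P 𝒰 (predictor P 𝒰 X) k ω := by
  have := drift_add_innovation (P := P) (𝒰 := 𝒰) (predictor P 𝒰 X) k ω
  rw [diffArray, uncenteredArray, eq_sub_of_add_eq' this]
  ring

theorem sum_range_uncenteredArray (X : ℕ → Ω → ℝ) (n : ℕ) (ω : Ω) :
    ∑ k ∈ Finset.range n, uncenteredArray P 𝒰 X n k ω
      = √n * (sampleMean X n ω - predictor P 𝒰 X n ω) := by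
  set Z := predictor P 𝒰 X with hZ
  rcases Nat.eq_zero_or_pos n with rfl | hn
  · simp
  have hn0 : (0 : ℝ) < n := by exact_mod_cast hn
  have hs : √(n : ℝ) ≠ 0 := (Real.sqrt_pos.2 hn0).ne'
  -- Each summand equals X_{k+1} + k Z_k - (k+1) Z_{k+1}.
  have h1 : ∀ m : ℕ, ∑ k ∈ Finset.range m,
      (X (k + 1) ω - Z k ω + ((k : ℝ) + 1) * (Z k ω - Z (k + 1) ω))
      = ∑ k ∈ Finset.range m, X (k + 1) ω - m * Z m ω := by
    intro m
    induction m with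
    | zero => simp
    | succ m ih =>
      rw [Finset.sum_range_succ, ih, Finset.sum_range_succ]
      push_cast
      ring
  have h2 : ∑ k ∈ Finset.range n, uncenteredArray P 𝒰 X n k ω
      = (∑ k ∈ Finset.range n,
        (X (k + 1) ω - Z k ω + ((k : ℝ) + 1) * (Z k ω - Z (k + 1) ω))) / √n := by
    rw [Finset.sum_div]
    refine Finset.sum_congr rfl fun k hk => ?_
    rw [uncenteredArray, rowCutoff, rowWeight, if_pos (Finset.mem_range.1 hk),
      if_pos (Finset.mem_range.1 hk)]
    ring
  rw [h2, h1, sampleMean, sum_Icc_one_eq_sum_range (fun i => X i ω), div_eq_iff hs, mul_right_comm,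
    Real.mul_self_sqrt hn0.le]
  field_simp

theorem sum_Ico_uncenteredArray (X : ℕ → Ω → ℝ) {n m : ℕ} (hnm : n ≤ m) (ω : Ω) :
    ∑ k ∈ Finset.Ico n m, uncenteredArray P 𝒰 X n k ω
      = √n * (predictor P 𝒰 X n ω - predictor P 𝒰 X m ω) := by
  rw [← neg_sub, ← Finset.sum_Ico_sub (fun k => predictor P 𝒰 X k ω) hnm,
    ← Finset.sum_neg_distrib, Finset.mul_sum]
  refine Finset.sum_congr rfl fun k hk => ?_
  have h := not_lt.2 (Finset.mem_Ico.1 hk).1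
  rw [uncenteredArray, rowCutoff, rowWeight, if_neg h, if_neg h]
  ring

/-- The two blocks of the row reproduce the average in (jjj) and a partial sum of the series in
(jv). -/
theorem sum_sq_uncenteredArray (X : ℕ → Ω → ℝ) {n m : ℕ} (hnm : n ≤ m) (ω : Ω) :
    ∑ k ∈ Finset.range m, uncenteredArray P 𝒰 X n k ω ^ 2
      = (1 / (n : ℝ)) * ∑ k ∈ Finset.Icc 1 n, (X k ω - predictor P 𝒰 X (k - 1) ω
          + (k : ℝ) * (predictor P 𝒰 X (k - 1) ω - predictor P 𝒰 X k ω)) ^ 2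
        + n * ∑ k ∈ Finset.Ico n m, (predictor P 𝒰 X k ω - predictor P 𝒰 X (k + 1) ω) ^ 2 := by
  rw [← Finset.sum_range_add_sum_Ico _ hnm, sum_Icc_one_eq_sum_range (fun k =>
    (X k ω - predictor P 𝒰 X (k - 1) ω
      + (k : ℝ) * (predictor P 𝒰 X (k - 1) ω - predictor P 𝒰 X k ω)) ^ 2),
    Finset.mul_sum, Finset.mul_sum]
  congr 1
  · refine Finset.sum_congr rfl fun k hk => ?_
    rw [uncenteredArray, rowCutoff, rowWeight, if_pos (Finset.mem_range.1 hk),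
      if_pos (Finset.mem_range.1 hk), Nat.add_sub_cancel]
    have e : 1 / √(n : ℝ) * (X (k + 1) ω - predictor P 𝒰 X k ω)
        + ((k : ℝ) + 1) / √n * (predictor P 𝒰 X k ω - predictor P 𝒰 X (k + 1) ω)
        = (X (k + 1) ω - predictor P 𝒰 X k ω
          + ((k : ℝ) + 1) * (predictor P 𝒰 X k ω - predictor P 𝒰 X (k + 1) ω)) / √n := by ring
    rw [e, div_pow, Real.sq_sqrt (Nat.cast_nonneg n)]
    push_cast
    ring
  · refine Finset.sum_congr rfl fun k hk => ?_
    have h := not_lt.2 (Finset.mem_Ico.1 hk).1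
    rw [uncenteredArray, rowCutoff, rowWeight, if_neg h, if_neg h, zero_mul, zero_add, mul_pow,
      Real.sq_sqrt (Nat.cast_nonneg n)]

theorem measurable_predictor (X : ℕ → Ω → ℝ) (n : ℕ) :
    Measurable (predictor P 𝒰 X n) :=
  stronglyMeasurable_condExp.measurable.mono (𝒰.le n) le_rfl

namespace IsPredictableSequence

variable {X : ℕ → Ω → ℝ}

theorem measurable_uncenteredArray (h : IsPredictableSequence P 𝒰 X) (n k : ℕ) :
    Measurable (uncenteredArray P 𝒰 X n k) :=
  (((h.measurable' k).sub (measurable_predictor X k)).const_mul _).add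
    (((measurable_predictor X k).sub (measurable_predictor X (k + 1))).const_mul _)

theorem measurable_sampleMean (h : IsPredictableSequence P 𝒰 X) (n : ℕ) :
    Measurable (sampleMean X n) := by
  have e : sampleMean X n = fun ω => (∑ k ∈ Finset.range n, X (k + 1) ω) / n := by
    ext ω
    rw [sampleMean, sum_Icc_one_eq_sum_range (fun i => X i ω)]
  rw [e]
  exact (Finset.measurable_sum _ fun k _ => h.measurable' k).div_const _

variable [IsProbabilityMeasure P]

/-- Stable convergence of `√n (X̄ₙ - Lₙ)`, where `Lₙ` is close to a predictor `Z_{r n}` with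
`r n ≥ n`. -/
theorem stablyConverges_sampleMean_sub (h : IsPredictableSequence P 𝒰 X) {U V V' W : Ω → ℝ}
    (hW : Measurable W) (hWU : ∀ ω, W ω = U ω + V' ω)
    (hsup : IncrementSupIntegrable P (predictor P 𝒰 X))
    (hU : NormalizedSquaresTendsto P X (predictor P 𝒰 X) U)
    (hV : TailSquaresTendsto P (predictor P 𝒰 X) V)
    {r : ℕ → ℕ} (hr : ∀ n, n ≤ r n)
    (hV' : TendstoInMeasure P (fun (n : ℕ) ω => (n : ℝ) * ∑ k ∈ Finset.Ico n (r n),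
      (predictor P 𝒰 X k ω - predictor P 𝒰 X (k + 1) ω) ^ 2) atTop V')
    {L : ℕ → Ω → ℝ} (hLm : ∀ n, Measurable (L n))
    (hL : TendstoInMeasure P (fun (n : ℕ) ω => √n * (predictor P 𝒰 X (r n) ω - L n ω)) atTop
      fun _ => (0 : ℝ)) :
    StablyConverges P (fun n ω => √n * (sampleMean X n ω - L n ω))
      (centeredGaussianKernel W hW) := by
  have hN := h.isNearMartingale
  set Z := predictor P 𝒰 X with hZ
  have hZm : ∀ n, Measurable (Z n) := measurable_predictor X
  have hdm : ∀ k, Measurable (drift P 𝒰 Z k) := fun k =>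
    (hN.measurable_drift k).mono (𝒰.le k) le_rfl
  have hum := h.measurable_uncenteredArray
  have hem : ∀ n k, Measurable fun ω => rowWeight n k * drift P 𝒰 Z k ω := fun n k =>
    (hdm k).const_mul _
  have hIco : ∀ n : ℕ, Measurable fun ω => (n : ℝ) * ∑ k ∈ Finset.Ico n (r n),
      (Z k ω - Z (k + 1) ω) ^ 2 := fun n =>
    (Finset.measurable_sum _ fun k _ => ((hZm k).sub (hZm (k + 1))).pow_const 2).const_mul _
  have hIcc : ∀ n : ℕ, AEStronglyMeasurable (fun ω => (1 / (n : ℝ)) *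
      ∑ k ∈ Finset.Icc 1 n, (X k ω - Z (k - 1) ω + (k : ℝ) * (Z (k - 1) ω - Z k ω)) ^ 2) P :=
    fun n => by
      refine ((Finset.measurable_sum _ fun k hk => Measurable.pow_const ?_ 2).const_mul
        _).aestronglyMeasurable
      -- Nothing is assumed about `X 0`; the sum starts at 1, so only terms `X (j + 1)` occur.
      obtain ⟨j, rfl⟩ := Nat.exists_eq_add_of_le' (Finset.mem_Icc.1 hk).1
      exact ((h.measurable' j).sub (hZm _)).add (((hZm _).sub (hZm _)).const_mul _)
  have hsq : TendstoInMeasure P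
      (fun n ω => ∑ k ∈ Finset.range (r n), uncenteredArray P 𝒰 X n k ω ^ 2) atTop W := by
    have h1 := tendstoInMeasure_add hIcc (fun n => (hIco n).aestronglyMeasurable) hU hV'
    refine (h1.congr_left fun n => ae_of_all _ fun ω => ?_).congr_right
      (ae_of_all _ fun ω => (hWU ω).symm)
    exact (sum_sq_uncenteredArray X (hr n) ω).symm
  have hesq : TendstoInMeasure P (fun n ω => ∑ k ∈ Finset.range (r n),
      (rowWeight n k * drift P 𝒰 Z k ω) ^ 2) atTop fun _ => (0 : ℝ) :=
    tendstoInMeasure_zero_of_abs_le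
      (fun n => (hN.integral_sum_sq_drift (rowWeight n) _).1.aestronglyMeasurable)
      (fun n => (hN.integral_sum_sq_drift (rowWeight n) _).1)
      (fun n ω => (abs_of_nonneg (Finset.sum_nonneg fun k _ => sq_nonneg _)).le)
      (fun n => (hN.integral_sum_sq_drift (rowWeight n) _).2.le)
      (hN.tendsto_sum_rowWeight_sq hr)
  have hq := tendstoInMeasure_sum_add_sq hum hem hsq hesq
  have he : TendstoInMeasure P (fun n ω => -∑ k ∈ Finset.range (r n),
      rowWeight n k * drift P 𝒰 Z k ω) atTop fun _ => (0 : ℝ) := by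
    have hi : ∀ n k, Integrable (fun ω => rowWeight n k * |drift P 𝒰 Z k ω|) P := fun n k =>
      (hN.integrable_drift k).abs.const_mul _
    refine tendstoInMeasure_zero_of_abs_le
      (fun n => (Finset.measurable_sum _ fun k _ => hem n k).neg.aestronglyMeasurable)
      (g := fun n ω => ∑ k ∈ Finset.range (r n), rowWeight n k * |drift P 𝒰 Z k ω|)
      (fun n => integrable_finsetSum _ fun k _ => hi n k) (fun n ω => ?_) (fun n => ?_)
      (hN.tendsto_sum_rowWeight hr)
    · rw [abs_neg]
      refine (Finset.abs_sum_le_sum_abs _ _).trans (Finset.sum_le_sum fun k _ => ?_)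
      rw [abs_mul, abs_of_nonneg (rowWeight_nonneg n k)]
    · rw [integral_finsetSum _ fun k _ => hi n k]
      simp_rw [integral_const_mul]
      exact le_rfl
  -- The row sums to √n (X̄ₙ - Z_{r n}) plus the weighted drifts, so these two terms are exactly
  -- what separates it from √n (X̄ₙ - Lₙ).
  have hrem := tendstoInMeasure_add
    (fun n => (Finset.measurable_sum _ fun k _ => hem n k).neg.aestronglyMeasurable)
    (fun n => (((hZm (r n)).sub (hLm n)).const_mul (√(n : ℝ))).aestronglyMeasurable) he hL
  refine stablyConverges_of_martingaleDiffArray (x := diffArray P 𝒰 X) h.measurable_diffArray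
    h.integrable_diffArray h.condExp_diffArray (h.tendsto_lintegral_iSup_diffArray hsup hV) hr hW
    (hq.congr_left fun n => ae_of_all _ fun ω => ?_)
    (fun n => ((h.measurable_sampleMean n).sub (hLm n)).const_mul _)
    ((hrem.congr_left fun n => ae_of_all _ fun ω => ?_).congr_right
      (ae_of_all _ fun ω => add_zero 0))
  · exact Finset.sum_congr rfl fun k _ => by rw [diffArray_eq]
  · simp_rw [diffArray_eq, Finset.sum_add_distrib]
    rw [← Finset.sum_range_add_sum_Ico (fun k => uncenteredArray P 𝒰 X n k ω) (hr n),
      sum_range_uncenteredArray, sum_Ico_uncenteredArray X (hr n)]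
    simp only [← hZ, Pi.neg_apply, Pi.sub_apply]
    ring

end IsPredictableSequence

end

theorem mainTheorem6 {Ω : Type*} {mΩ : MeasurableSpace Ω} (P : Measure Ω) [IsProbabilityMeasure P]
    (𝒰 : Filtration ℕ mΩ) (X : ℕ → Ω → ℝ)
    (hX_adapted : ∀ n : ℕ, 1 ≤ n → Measurable[𝒰 n] (X n))
    (hX_integrable : ∀ n : ℕ, 1 ≤ n → Integrable (X n) P)
    (hX_unifIntegrable : UniformIntegrable (fun (n : ℕ) ω => (X (n + 1) ω) ^ 2) 1 P)
    (hj : Tendsto (fun n : ℕ => (n : ℝ) ^ 3 *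
        ∫ ω, ((P[predictor P 𝒰 X (n + 1) | 𝒰 n]) ω - predictor P 𝒰 X n ω) ^ 2 ∂P)
      atTop (𝓝 0)) :
    ∃ Z : Ω → ℝ, Measurable Z ∧
      (∀ᵐ ω ∂P, Tendsto (fun n => predictor P 𝒰 X n ω) atTop (𝓝 (Z ω))) ∧
      (∀ᵐ ω ∂P, Tendsto (fun n => sampleMean X n ω) atTop (𝓝 (Z ω))) ∧
      ∀ (U V : Ω → ℝ) (hU : Measurable U) (hV : Measurable V),
        IncrementSupIntegrable P (predictor P 𝒰 X) →
        NormalizedSquaresTendsto P X (predictor P 𝒰 X) U →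
        TailSquaresTendsto P (predictor P 𝒰 X) V →
        StablyConverges P
            (fun n ω => Real.sqrt n * (sampleMean X n ω - predictor P 𝒰 X n ω))
            (centeredGaussianKernel U hU) ∧
          StablyConverges P
            (fun n ω => Real.sqrt n * (sampleMean X n ω - Z ω))
            (centeredGaussianKernel (fun ω => U ω + V ω) (hU.add hV)) := by
  have h : IsPredictableSequence P 𝒰 X :=
    ⟨fun k => hX_adapted (k + 1) (Nat.le_add_left 1 k), hX_unifIntegrable, hj⟩
  obtain ⟨Z, hZm, hZ⟩ := h.exists_limit
  refine ⟨Z, hZm, hZ, h.tendsto_sampleMean hZ, fun U V hU hV hsup hSq hTail => ⟨?_, ?_⟩⟩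
  -- With r n = n and Lₙ = Zₙ the second block is empty and there is no error in the centering.
  · refine h.stablyConverges_sampleMean_sub (V' := fun _ => 0) (r := fun n => n) hU
      (fun ω => (add_zero _).symm) hsup hSq hTail (fun n => le_rfl) ?_ (measurable_predictor X) ?_
    · simpa using tendstoInMeasure_of_tendsto_ae (μ := P) (f := fun (_ : ℕ) (_ : Ω) => (0 : ℝ))
        (fun _ => aestronglyMeasurable_const) (ae_of_all _ fun _ => tendsto_const_nhds)
    · simpa using tendstoInMeasure_of_tendsto_ae (μ := P) (f := fun (_ : ℕ) (_ : Ω) => (0 : ℝ))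
        (fun _ => aestronglyMeasurable_const) (ae_of_all _ fun _ => tendsto_const_nhds)
  · have hZM : TendstoInMeasure P (predictor P 𝒰 X) atTop Z :=
      tendstoInMeasure_of_tendsto_ae (fun n => (measurable_predictor X n).aestronglyMeasurable) hZ
    -- One `r` must meet two demands: √n (Z_{r n} - Z) → 0 in probability, and r n ≥ n² + n so that
    -- the truncated series in (jv) keeps the limit V.
    obtain ⟨r, hr, hrL⟩ := exists_seq_tendstoInMeasure_smul hZM (fun n => √(n : ℝ))
      fun n => n ^ 2 + n
    refine h.stablyConverges_sampleMean_sub (V' := V) (r := r) (hU.add hV) (fun ω => rfl) hsup hSq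
      hTail (fun n => (Nat.le_add_left n (n ^ 2)).trans (hr n)) ?_ (fun _ => hZm) hrL
    refine tendstoInMeasure_of_tendsto_ae (fun n => ?_) ?_
    · exact ((Finset.measurable_sum _ fun k _ => ((measurable_predictor X k).sub
        (measurable_predictor X (k + 1))).pow_const 2).const_mul _).aestronglyMeasurable
    · filter_upwards [hTail] with ω ⟨h1, h2⟩
      exact tendsto_mul_sum_Ico_of_tendsto_tsum h1 h2 hr
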